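/- Let $\mathbb F$ be any field, let $d=d(n)$ satisfy $d(n)\to\infty$ and $d(n)=O(\log n/\log\log n)$, and let $M=(M_n)$ be a sequence of $n^{d}\times n^{d}$ matrices over $\mathbb F$, with rows and columns indexed by $[n]^d$. For $\kappa\subseteq[d]$, the partial transpose $P^{\top_\kappa}$ of an $n^d\times n^d$ matrix $P$ is obtained by swapping the row index $i_k$ and the column index $j_k$ for every $k\in\kappa$; $P$ is PT-basic if $\mathrm{rank}(P^{\top_\kappa})=1$ for some $\kappa\subseteq[d]$; and $\mathrm{PT\text{-}rank}(M)$ is the minimum number of PT-basic matrices that sum to $M$. Let $$\widetilde Q_M=\sum_{\vec i,\vec j\in[n]^d}M_{\vec i,\vec j}\;X^{(0)}_{i_1}X^{(1)}_{j_1,i_2}\cdots X^{(d-1)}_{j_{d-1},i_d}X^{(d)}_{j_d}.$$ Suppose that $M$ is explicit: there are finitely many fixed elements $c_1,\dots,c_m\in\mathbb F$ and a Turing machine that, given $n\ge 1$ and $\vec i,\vec j\in[n]^d$ in binary, outputs in time $\mathrm{polylog}(n)$ the entry $M_{\vec i,\vec j}$, written as a sum of products of the $c_k$ (for example, an integer in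 binary is a sum of powers of $2$). Suppose that $\mathrm{PT\text{-}rank}(M)=n^{d-o(\log d)}$ as $n\to\infty$, where $\log d$ is to base $2$. Then the arithmetic formula size of $\widetilde Q_M$ over $\mathbb F$ (the minimum number of leaves of a formula with gates $+,\times$ and leaves labelled by variables or elements of $\mathbb F$) is at least $n^{(1-o(1))\log_2 d}$, and hence $\mathsf{VNC}^1\neq\mathsf{VNP}$ over $\mathbb F$. Here $\mathsf{VNC}^1$ and $\mathsf{VP}$ are the classes of sequences of polynomials over $\mathbb F$ with polynomially bounded degree and number of variables that have arithmetic formulas, respectively arithmetic circuits, of polynomially bounded size; $\mathsf{VNP}$ consists of the sequences $(f_n)$ with polynomially bounded degree and number of variables such that $f_n(x)=\sum_{e\in\{0,1\}^{u(n)}}g_n(x,e)$ for a polynomially bounded $u$ and some $(g_n)\in\mathsf{VP}$. -/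

import Mathlib

/-! ### Partial transposes and partial transpose rank -/

/-- The `κ`-partial transpose of an `n^d × n^d` matrix (rows and columns indexed by `[n]^d`):
for every `k ∈ κ` the row index `i k` and the column index `j k` are swapped. -/
def partialTranspose {F : Type*} {n d : ℕ} (κ : Finset (Fin d))
    (M : Matrix (Fin d → Fin n) (Fin d → Fin n) F) :
    Matrix (Fin d → Fin n) (Fin d → Fin n) F :=
  fun i j => M (fun k => if k ∈ κ then j k else i k) (fun k => if k ∈ κ then i k else j k)

/-- A matrix is PT-basic if one of its partial transposes has rank one. -/
def IsPTBasic {F : Type*} [Field F] {n d : ℕ}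
    (P : Matrix (Fin d → Fin n) (Fin d → Fin n) F) : Prop :=
  ∃ κ : Finset (Fin d), (partialTranspose κ P).rank = 1

/-- The PT-rank: the minimum number of PT-basic matrices that sum to `M`. -/
noncomputable def ptRank {F : Type*} [Field F] {n d : ℕ}
    (M : Matrix (Fin d → Fin n) (Fin d → Fin n) F) : ℕ :=
  sInf {r : ℕ | ∃ P : Fin r → Matrix (Fin d → Fin n) (Fin d → Fin n) F,
    (∀ s, IsPTBasic (P s)) ∧ M = ∑ s, P s}

/-! ### The multilinear polynomial of a matrix -/

/-- Variables `X^{(k)}_{a,b}`, `k = 0, …, d`.  In `qTilde`, the left index `a` is absent (`none`)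
for `k = 0` and the right index `b` is absent for `k = d`. -/
abbrev ShiftVar (n d : ℕ) : Type := Fin (d + 1) × Option (Fin n) × Option (Fin n)

/-- `∑_{i,j} M_{i,j} X^{(0)}_{i_1} X^{(1)}_{j_1,i_2} ⋯ X^{(d-1)}_{j_{d-1},i_d} X^{(d)}_{j_d}`.
The left indices of the factors `k = 0, …, d` are `none, j_1, …, j_d` and the right
indices are `i_1, …, i_d, none`. -/
noncomputable def qTilde {F : Type*} [Field F] {n d : ℕ}
    (M : Matrix (Fin d → Fin n) (Fin d → Fin n) F) : MvPolynomial (ShiftVar n d) F :=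
  ∑ i : Fin d → Fin n, ∑ j : Fin d → Fin n,
    MvPolynomial.C (M i j) *
      ∏ k : Fin (d + 1), MvPolynomial.X
        (k, Fin.cons (α := fun _ => Option (Fin n)) none (fun l => some (j l)) k,
          Fin.snoc (α := fun _ => Option (Fin n)) (fun l => some (i l)) none k)

/-! ### Arithmetic formulas and circuits -/

/-- Arithmetic formulas over `F`: binary trees with leaves labelled by field
elements or variables and inner nodes labelled by `+` or `×`. -/
inductive ArithFormula (F : Type*) (V : Type*) where
  | const (c : F)
  | var (x : V)
  | add (φ ψ : ArithFormula F V)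
  | mul (φ ψ : ArithFormula F V)

namespace ArithFormula

/-- The polynomial computed by a formula. -/
noncomputable def eval {F V : Type*} [Field F] : ArithFormula F V → MvPolynomial V F
  | const c => MvPolynomial.C c
  | var x => MvPolynomial.X x
  | add φ ψ => φ.eval + ψ.eval
  | mul φ ψ => φ.eval * ψ.eval

/-- The size of a formula: its number of leaves. -/
def size {F V : Type*} : ArithFormula F V → ℕ
  | const _ => 1
  | var _ => 1
  | add φ ψ => φ.size + ψ.size
  | mul φ ψ => φ.size + ψ.size

end ArithFormula

/-- The arithmetic formula size of a polynomial. -/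
noncomputable def formulaSize {F V : Type*} [Field F] (p : MvPolynomial V F) : ℕ :=
  sInf {s : ℕ | ∃ φ : ArithFormula F V, φ.eval = p ∧ φ.size = s}

/-- Gates of an arithmetic circuit; `add i j` and `mul i j` refer to the results of the
gates number `i` and `j` (counted from `0`). -/
inductive ArithGate (F : Type*) (V : Type*) where
  | const (c : F)
  | var (x : V)
  | add (i j : ℕ)
  | mul (i j : ℕ)

/-- The polynomial computed by a gate from the list of the results of the earlier gates
(a reference to anything but an earlier gate reads `0`). -/
noncomputable def ArithGate.value {F V : Type*} [Field F] (prev : List (MvPolynomial V F)) :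
    ArithGate F V → MvPolynomial V F
  | const c => MvPolynomial.C c
  | var x => MvPolynomial.X x
  | add i j => prev.getD i 0 + prev.getD j 0
  | mul i j => prev.getD i 0 * prev.getD j 0

/-- An arithmetic circuit: its gates in topological order.  Its size is the length of the list. -/
abbrev ArithCircuit (F : Type*) (V : Type*) := List (ArithGate F V)

/-- The polynomial computed by a circuit: the result of its last gate. -/
noncomputable def ArithCircuit.eval {F V : Type*} [Field F] (Γ : ArithCircuit F V) :
    MvPolynomial V F :=
  (Γ.foldl (fun prev g => prev ++ [g.value prev]) []).getLastD 0

/-! ### The classes `VNC¹`, `VP` and `VNP` -/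

/-- Functions bounded by a polynomial. -/
def PolyBounded (t : ℕ → ℕ) : Prop := ∃ c : ℕ, ∀ n, t n ≤ n ^ c + c

/-- A sequence of polynomials `poly n ∈ F[x_1, …, x_{numVars n}]`. -/
structure PolySeq (F : Type*) [Field F] where
  numVars : ℕ → ℕ
  poly : ∀ n, MvPolynomial (Fin (numVars n)) F

/-- A p-family: number of variables and degree are polynomially bounded. -/
def PolySeq.IsPFamily {F : Type*} [Field F] (f : PolySeq F) : Prop :=
  PolyBounded f.numVars ∧ PolyBounded fun n => (f.poly n).totalDegree

/-- `VNC¹` (also called `VF`): p-families with arithmetic formulas of polynomial size. -/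
def VNC1 (F : Type*) [Field F] : Set (PolySeq F) :=
  {f | f.IsPFamily ∧ ∃ s : ℕ → ℕ, PolyBounded s ∧
    ∀ n, ∃ φ : ArithFormula F (Fin (f.numVars n)), φ.eval = f.poly n ∧ φ.size ≤ s n}

/-- `VP`: p-families with arithmetic circuits of polynomial size. -/
def VP (F : Type*) [Field F] : Set (PolySeq F) :=
  {f | f.IsPFamily ∧ ∃ s : ℕ → ℕ, PolyBounded s ∧
    ∀ n, ∃ Γ : ArithCircuit F (Fin (f.numVars n)), Γ.eval = f.poly n ∧ Γ.length ≤ s n}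

/-- `VNP`: p-families of the form `f_n(x) = ∑_{e ∈ {0,1}^{u(n)}} g_n(x, e)` with `(g_n) ∈ VP`
and `u` polynomially bounded. -/
def VNP (F : Type*) [Field F] : Set (PolySeq F) :=
  {f | f.IsPFamily ∧ ∃ u : ℕ → ℕ, PolyBounded u ∧
    ∃ g : ∀ n, MvPolynomial (Fin (f.numVars n + u n)) F,
      (⟨fun n => f.numVars n + u n, g⟩ : PolySeq F) ∈ VP F ∧
      ∀ n, f.poly n = ∑ e : Fin (u n) → Bool,
        MvPolynomial.aeval
          (Fin.append (fun k => MvPolynomial.X k)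
            (fun k => if e k then (1 : MvPolynomial (Fin (f.numVars n)) F) else 0)) (g n)}

/-! ### Explicit sequences of matrices -/

/-- The field element written as a sum of monomials in the constants `c`: the symbol `some k`
stands for the factor `c k`, and the symbol `none` ends a monomial.  So `some 0, some 1, none,
some 2, none` is `c 0 * c 1 + c 2`, the word `none` is `1` and the empty word is `0`.
(The pair is the sum of the finished monomials and the current unfinished monomial.) -/
def wordValue {F : Type*} [Field F] {m : ℕ} (c : Fin m → F) (w : List (Option (Fin m))) : F :=
  (w.foldl (fun (st : F × F) (x : Option (Fin m)) =>
    match x with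
    | some k => (st.1, st.2 * c k)
    | none => (st.1 + st.2, 1)) (0, 1)).1

/-- A list of natural numbers in binary (least significant bit first), each number being
terminated by the symbol `none`. -/
def encodeNats (l : List ℕ) : List (Option Bool) :=
  l.flatMap fun a => (Nat.bits a).map some ++ [none]

/-- The input `n, i_1, …, i_d, j_1, …, j_d`. -/
def encodeEntry {d : ℕ} (n : ℕ) (i j : Fin d → Fin n) : List (Option Bool) :=
  encodeNats (n :: (List.ofFn fun k => (i k : ℕ)) ++ List.ofFn fun k => (j k : ℕ))

/-- A sequence of `n^d × n^d` matrices, `d = d(n)`, is explicit if some Turing machine, given `n`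
and `i, j ∈ [n]^d` in binary, outputs the entry `M_{i,j}` in time polylogarithmic in `n`.
Entries are written as sums of monomials in finitely many field elements `c`, which are fixed
for the whole sequence. -/
def IsExplicit {F : Type*} [Field F] (d : ℕ → ℕ)
    (M : ∀ n, Matrix (Fin (d n) → Fin n) (Fin (d n) → Fin n) F) : Prop :=
  ∃ (m : ℕ) (c : Fin m → F) (T : Turing.TM2ComputableAux (Option Bool) (Option (Fin m))) (a : ℕ),
    ∀ n, 0 < n → ∀ i j : Fin (d n) → Fin n, ∃ w : List (Option (Fin m)),
      wordValue c w = M n i j ∧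
      Nonempty (Turing.TM2OutputsInTime T.tm
        ((encodeEntry n i j).map T.inputAlphabet.symm)
        (some (w.map T.outputAlphabet.symm))
        ((Nat.log 2 n + 2) ^ a))

/-! Lower bound. Group the variables of `qTilde M` into the blocks `k = 0, …, d`. A log-product on a
set `S` of blocks is a product of functions of disjoint parts of `S` with at least `1 + log₂ |S|`
parts. Such products arise naturally: when two polynomials are multiplied and the blocks are split
between them, the larger share keeps its decomposition and the smaller share is one more part, while
the number of blocks at most doubles (`IsLogProduct.mul`, `HasLogSums.mul`). To keep their number
nearly linear in the formula size `s`, the formula is written as `A * v + B`, where the gate `v`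
contains almost all leaves but its arguments have lost a fraction `1/q`. Induction
(`ArithFormula.hasLogSums`) gives at most `s * 2 ^ log_q s * (2k+1)^(d+1)` log-products for the
coefficients of `qTilde M`, with `k = O(q log s)`. For `q = 2 ^ m` the first two factors are at most
`s ^ (1 + 1/m)`. A log-product has small PT-rank. Colour its parts with two colours so that the path
of blocks `0, …, d` changes colour at least `log₂ d` times (`exists_two_coloring`). At each change
the indices `i_k` and `j_k` belong to different colour classes, and a partial transpose puts one
class into the rows and the other into the columns. The other pairs cost a factor `n` each, so the
PT-rank is at most `n ^ (d - log₂ d)` (`isPTSum_of_two_coloring`). Since `d = O(log n / log log n)`,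
the factor `(2k+1)^(d+1)` is only `n ^ O(1)`, which is negligible against `n ^ log₂ d`. Comparison
with the assumed PT-rank yields the bound on `s`. Separation. The bound is superpolynomial, so it
remains to place `qTilde M` in `VNP`. A Boolean straight-line program of polynomial length simulates
the machine for the entries (`exists_generates_output`). Its values become auxiliary Boolean
variables, whose correctness is tested by a polynomial with a small formula
(`exists_check_polynomial`). Summing over one-hot encodings of `(i, j)` and over these variables
gives `qTilde M` (`exists_boolSum_eq_qTilde`). -/

/-! ### Set-multilinear components -/

section Components

open Finset

variable {K W F : Type*} [DecidableEq K]

/-- The monomial `∏_{k ∈ S} X_{k, x k}`. -/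
noncomputable def blockMonomial (S : Finset K) (x : K → W) : K × W →₀ ℕ :=
  ∑ k ∈ S, Finsupp.single (k, x k) 1

theorem blockMonomial_apply [DecidableEq W] (S : Finset K) (x : K → W) (k : K) (w : W) :
    blockMonomial S x (k, w) = if k ∈ S ∧ x k = w then 1 else 0 := by
  classical
  simp only [blockMonomial, Finsupp.finsetSum_apply, Finsupp.single_apply, Prod.mk.injEq]
  rw [Finset.sum_boole]
  by_cases h : k ∈ S ∧ x k = w
  · rw [if_pos h]
    have : ({a ∈ S | a = k ∧ x a = w} : Finset K) = {k} := by
      ext a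
      simp only [Finset.mem_filter, Finset.mem_singleton]
      constructor
      · exact fun h => h.2.1
      · rintro rfl
        exact ⟨h.1, rfl, h.2⟩
    simp [this]
  · rw [if_neg h]
    have : ({a ∈ S | a = k ∧ x a = w} : Finset K) = ∅ := by
      ext a
      simp only [Finset.mem_filter, Finset.notMem_empty, iff_false]
      rintro ⟨h1, rfl, h2⟩
      exact h ⟨h1, h2⟩
    simp [this]

theorem blockMonomial_union {S T : Finset K} (h : Disjoint S T) (x : K → W) :
    blockMonomial (S ∪ T) x = blockMonomial S x + blockMonomial T x :=
  Finset.sum_union h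

omit [DecidableEq K] in
theorem blockMonomial_congr {S : Finset K} {x y : K → W} (h : ∀ k ∈ S, x k = y k) :
    blockMonomial S x = blockMonomial S y :=
  Finset.sum_congr rfl fun k hk => by rw [h k hk]

theorem blockMonomial_injective (x : K → W) : Function.Injective fun S => blockMonomial S x := by
  classical
  intro S T h
  ext k
  have := DFunLike.congr_fun h (k, x k)
  simp only [blockMonomial_apply, and_true] at this
  split_ifs at this <;> simp_all

/-- All exponents are 0 or 1, so each variable goes to exactly one of the two factors and a
factorization is a splitting of the set of blocks. -/
theorem antidiagonal_blockMonomial [DecidableEq W] (S : Finset K) (x : K → W) :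
    antidiagonal (blockMonomial S x) =
      S.powerset.image fun T => (blockMonomial T x, blockMonomial (S \ T) x) := by
  classical
  ext ⟨a, b⟩
  simp only [HasAntidiagonal.mem_antidiagonal, mem_image, mem_powerset, Prod.mk.injEq]
  constructor
  · intro h
    have hv : ∀ k w, a (k, w) + b (k, w) = if k ∈ S ∧ x k = w then 1 else 0 := fun k w => by
      rw [← blockMonomial_apply, ← h, Finsupp.add_apply]
    refine ⟨S.filter fun k => a (k, x k) = 1, filter_subset _ _, ?_, ?_⟩
    all_goals
      ext ⟨k, w⟩
      have := hv k w
      rw [blockMonomial_apply]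
      simp only [mem_filter, mem_sdiff]
      by_cases hw : x k = w
      · subst hw
        grind
      · simp only [hw, and_false, if_false] at this ⊢
        omega
  · rintro ⟨T, hT, rfl, rfl⟩
    rw [← blockMonomial_union disjoint_sdiff, union_sdiff_of_subset hT]

variable [Field F]

/-- The coefficients of the monomials of `p` with exactly one variable from each block in `S` and
no other variables. -/
noncomputable def blockCoeff (p : MvPolynomial (K × W) F) (S : Finset K) (x : K → W) : F :=
  p.coeff (blockMonomial S x)

omit [DecidableEq K] in
theorem blockCoeff_add (p q : MvPolynomial (K × W) F) (S : Finset K) :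
    blockCoeff (p + q) S = blockCoeff p S + blockCoeff q S := by
  ext x
  simp [blockCoeff]

theorem blockCoeff_mul (p q : MvPolynomial (K × W) F) (S : Finset K) :
    blockCoeff (p * q) S = ∑ T ∈ S.powerset, blockCoeff p T * blockCoeff q (S \ T) := by
  classical
  ext x
  simp only [blockCoeff, MvPolynomial.coeff_mul, Finset.sum_apply, Pi.mul_apply]
  rw [antidiagonal_blockMonomial, Finset.sum_image]
  intro T _ U _ h
  exact blockMonomial_injective x (Prod.ext_iff.1 h).1

omit [DecidableEq K] in
theorem dependsOn_blockCoeff (p : MvPolynomial (K × W) F) (S : Finset K) :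
    DependsOn (blockCoeff p S) (S : Set K) := by
  intro x y h
  simp only [blockCoeff]
  rw [blockMonomial_congr fun k hk => h k hk]

/-! ### Sums of products with logarithmically many factors -/

/-- `f` is a product of functions of disjoint nonempty sets of blocks that partition `S`, with at
least `1 + log₂ |S|` factors. -/
def IsLogProduct (S : Finset K) (f : (K → W) → F) : Prop :=
  ∃ P : Finpartition S, S.card ≤ 2 ^ (P.parts.card - 1) ∧
    ∃ g : Finset K → (K → W) → F, (∀ B, DependsOn (g B) (B : Set K)) ∧ f = ∏ B ∈ P.parts, g B

/-- `f` is a sum of at most `r` products with logarithmically many factors. -/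
def IsLogSum (S : Finset K) (r : ℕ) (f : (K → W) → F) : Prop :=
  ∃ l : List ((K → W) → F), l.length ≤ r ∧ (∀ h ∈ l, IsLogProduct S h) ∧ l.sum = f

/-- Needed for the terms of a product in which one polynomial contributes only its constant
coefficient; the scalar is absorbed by any one part. -/
theorem IsLogProduct.mul_const {S : Finset K} (hS : S.Nonempty) {f h : (K → W) → F}
    (hf : IsLogProduct S f) (hh : DependsOn h (∅ : Set K)) : IsLogProduct S (f * h) := by
  classical
  obtain ⟨P, hP, g, hg, rfl⟩ := hf
  obtain ⟨B, hB⟩ := P.parts_nonempty hS.ne_empty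
  refine ⟨P, hP, Function.update g B (g B * h), fun C => ?_, ?_⟩
  · by_cases hC : C = B
    · subst hC
      rw [Function.update_self]
      intro x y hxy
      simp only [Pi.mul_apply]
      rw [hg C hxy, hh (fun i hi => hi.elim)]
    · rw [Function.update_of_ne hC]
      exact hg C
  · rw [Finset.prod_update_of_mem hB, ← Finset.mul_prod_erase _ _ hB, Finset.sdiff_singleton_eq_erase]
    ring

/-- `U` becomes one further part. As `|T ∪ U| ≤ 2 |T|`, one additional factor is exactly what the
logarithmic bound requires. -/
theorem IsLogProduct.mul {T U : Finset K} (hU : U.Nonempty) (hTU : Disjoint T U)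
    (hc : U.card ≤ T.card) {f h : (K → W) → F}
    (hf : IsLogProduct T f) (hh : DependsOn h (U : Set K)) : IsLogProduct (T ∪ U) (f * h) := by
  classical
  obtain ⟨P, hP, g, hg, rfl⟩ := hf
  have hUP : U ∉ P.parts := fun hm => by
    have := P.le hm
    exact hU.ne_empty (disjoint_self.1 (hTU.mono_left this))
  have hT : T.Nonempty := card_pos.1 (hU.card_pos.trans_le hc)
  have hpos : 0 < P.parts.card := card_pos.2 (P.parts_nonempty hT.ne_empty)
  refine ⟨P.extend hU.ne_empty hTU rfl, ?_, Function.update g U h, fun C => ?_, ?_⟩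
  · rw [Finpartition.card_extend, card_union_of_disjoint hTU]
    have : 2 ^ (P.parts.card + 1 - 1) = 2 * 2 ^ (P.parts.card - 1) := by
      rw [← pow_succ']
      congr 1
      omega
    omega
  · by_cases hC : C = U
    · subst hC
      rw [Function.update_self]
      exact hh
    · rw [Function.update_of_ne hC]
      exact hg C
  · rw [Finpartition.extend_parts, prod_insert hUP, Function.update_self, mul_comm]
    congr 1
    refine prod_congr rfl fun B hB => ?_
    rw [Function.update_of_ne]
    rintro rfl
    exact hUP hB

theorem IsLogSum.mono {S : Finset K} {r r' : ℕ} (h : r ≤ r') {f : (K → W) → F}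
    (hf : IsLogSum S r f) : IsLogSum S r' f :=
  let ⟨l, hl, h1, h2⟩ := hf
  ⟨l, hl.trans h, h1, h2⟩

theorem IsLogSum.zero (S : Finset K) (r : ℕ) : IsLogSum S r (0 : (K → W) → F) :=
  ⟨[], Nat.zero_le _, by simp, rfl⟩

theorem IsLogSum.add {S : Finset K} {a b : ℕ} {f g : (K → W) → F}
    (hf : IsLogSum S a f) (hg : IsLogSum S b g) : IsLogSum S (a + b) (f + g) := by
  obtain ⟨l, hl, h1, rfl⟩ := hf
  obtain ⟨m, hm, h2, rfl⟩ := hg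
  refine ⟨l ++ m, by simp; omega, ?_, by simp⟩
  intro h hh
  rcases List.mem_append.1 hh with hh | hh
  exacts [h1 h hh, h2 h hh]

theorem IsLogSum.sum {S : Finset K} {ι : Type*} (s : Finset ι) {r : ι → ℕ}
    {f : ι → (K → W) → F} (h : ∀ i ∈ s, IsLogSum S (r i) (f i)) :
    IsLogSum S (∑ i ∈ s, r i) (∑ i ∈ s, f i) := by
  classical
  induction s using Finset.induction_on with
  | empty => exact IsLogSum.zero _ _
  | insert i s hi ih =>
    rw [sum_insert hi, sum_insert hi]
    exact (h i (mem_insert_self _ _)).add (ih fun j hj => h j (mem_insert_of_mem hj))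

theorem IsLogSum.mul {T U : Finset K} (hT : T.Nonempty) (hTU : Disjoint T U)
    (hc : U.card ≤ T.card) {r : ℕ} {f h : (K → W) → F}
    (hf : IsLogSum T r f) (hh : DependsOn h (U : Set K)) : IsLogSum (T ∪ U) r (f * h) := by
  obtain ⟨l, hl, h1, rfl⟩ := hf
  refine ⟨l.map (· * h), by simpa using hl, ?_, by rw [List.sum_map_mul_right, List.map_id']⟩
  simp only [List.mem_map]
  rintro _ ⟨g, hg, rfl⟩
  rcases U.eq_empty_or_nonempty with rfl | hU
  · rw [union_empty]
    exact (h1 g hg).mul_const hT (by simpa using hh)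
  · exact (h1 g hg).mul hU hTU hc hh

/-- The set-multilinear components of `p` are sums of at most `a * D ^ |S|` products with
logarithmically many factors. -/
def HasLogSums (a D : ℕ) (p : MvPolynomial (K × W) F) : Prop :=
  ∀ S : Finset K, S.Nonempty → IsLogSum S (a * D ^ S.card) (blockCoeff p S)

theorem HasLogSums.mono {a b D E : ℕ} (hab : a ≤ b) (hDE : D ≤ E) {p : MvPolynomial (K × W) F}
    (hp : HasLogSums a D p) : HasLogSums b E p := fun S hS =>
  (hp S hS).mono (Nat.mul_le_mul hab (Nat.pow_le_pow_left hDE _))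

theorem HasLogSums.add {a b D : ℕ} {p q : MvPolynomial (K × W) F}
    (hp : HasLogSums a D p) (hq : HasLogSums b D q) : HasLogSums (a + b) D (p + q) := by
  intro S hS
  rw [blockCoeff_add, add_mul]
  exact (hp S hS).add (hq S hS)

/-- For each splitting `S = T ∪ (S \ T)` the larger side keeps its decomposition and the smaller
side enters as a single factor. By the binomial theorem the sum of `D ^ |T|` over all `T ⊆ S` is `(D
+ 1) ^ |S|`; hence the coefficients `a` and `b` add up instead of multiplying. -/
theorem HasLogSums.mul {a b D : ℕ} {p q : MvPolynomial (K × W) F}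
    (hp : HasLogSums a D p) (hq : HasLogSums b D q) : HasLogSums (a + b) (D + 1) (p * q) := by
  intro S hS
  rw [blockCoeff_mul]
  have key : ∀ T ∈ S.powerset,
      IsLogSum S (a * D ^ T.card + b * D ^ (S.card - T.card))
        (blockCoeff p T * blockCoeff q (S \ T)) := by
    intro T hT
    rw [mem_powerset] at hT
    have hc := card_sdiff_of_subset hT
    have hle := card_le_card hT
    have hSpos := hS.card_pos
    rcases le_total (S \ T).card T.card with h | h
    · have hTn : T.Nonempty := card_pos.1 (by omega)
      have := (hp T hTn).mul hTn disjoint_sdiff h (dependsOn_blockCoeff q (S \ T))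
      rw [union_sdiff_of_subset hT] at this
      exact this.mono (Nat.le_add_right _ _)
    · have hTn : (S \ T).Nonempty := card_pos.1 (by omega)
      have := (hq _ hTn).mul hTn disjoint_sdiff.symm h (dependsOn_blockCoeff p T)
      rw [sdiff_union_of_subset hT, hc, mul_comm (blockCoeff q _)] at this
      exact this.mono (Nat.le_add_left _ _)
  refine (IsLogSum.sum _ key).mono (le_of_eq ?_)
  rw [sum_add_distrib, ← mul_sum, ← mul_sum, add_mul]
  congr 2
  · simpa using sum_pow_mul_eq_add_pow D 1 S
  · simpa [add_comm] using sum_pow_mul_eq_add_pow 1 D S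

theorem isLogProduct_of_card_eq_one {S : Finset K} (hS : S.card = 1) {f : (K → W) → F}
    (hf : DependsOn f (S : Set K)) : IsLogProduct S f := by
  have hne : S ≠ ⊥ := by
    rintro rfl
    simp at hS
  refine ⟨Finpartition.indiscrete hne, by simp [hS], fun B => if B = S then f else 1, ?_, by simp⟩
  intro B
  dsimp only
  split_ifs with h
  · exact h ▸ hf
  · intro x y _
    rfl

omit [DecidableEq K] in
theorem degree_blockMonomial (S : Finset K) (x : K → W) :
    (blockMonomial S x).degree = S.card := by
  simp [blockMonomial, map_sum]

/-- Two or more blocks would need degree two; a single block is a log-product with one part, since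
`1 ≤ 2 ^ 0`. -/
theorem hasLogSums_of_totalDegree_le_one {p : MvPolynomial (K × W) F} (hp : p.totalDegree ≤ 1) :
    HasLogSums 1 1 p := by
  intro S hS
  rw [one_pow, mul_one]
  rcases Nat.lt_or_ge 1 S.card with h | h
  · have : blockCoeff p S = 0 := by
      ext x
      refine MvPolynomial.coeff_eq_zero_of_totalDegree_lt (lt_of_le_of_lt hp ?_)
      have := degree_blockMonomial S x
      rw [Finsupp.degree_apply] at this
      rwa [this]
    rw [this]
    exact IsLogSum.zero _ _
  · refine ⟨[blockCoeff p S], by simp, ?_, by simp⟩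
    simp only [List.mem_singleton, forall_eq]
    exact isLogProduct_of_card_eq_one (le_antisymm h hS.card_pos) (dependsOn_blockCoeff p S)

end Components

/-! ### Log-product decompositions of formulas -/

section FormulaDecomposition

namespace ArithFormula

variable {F V : Type*}

theorem size_pos (φ : ArithFormula F V) : 0 < φ.size := by
  induction φ with
  | const | var => exact Nat.one_pos
  | add φ ψ h1 h2 | mul φ ψ h1 h2 => exact Nat.add_pos_left h1 _

variable [Field F]

/-- Some gate of `φ` has size greater than `t` while its arguments have size at most `t`, and `φ`
is an affine function of that gate, with coefficients computed by small formulas. -/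
theorem exists_affine_decomposition (φ : ArithFormula F V) {t : ℕ} (ht : 0 < t)
    (hφ : t < φ.size) :
    ∃ α β : ArithFormula F V, α.size ≤ t ∧ β.size ≤ t ∧ t < α.size + β.size ∧
      ∃ v : MvPolynomial V F, (v = α.eval + β.eval ∨ v = α.eval * β.eval) ∧
        ((φ.size = α.size + β.size ∧ φ.eval = v) ∨
          ∃ A B : ArithFormula F V, A.size + (α.size + β.size) ≤ φ.size ∧
            B.size + (α.size + β.size) ≤ φ.size ∧ φ.eval = A.eval * v + B.eval) := by
  induction φ with
  | const c => exact absurd hφ (by simp [size]; omega)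
  | var x => exact absurd hφ (by simp [size]; omega)
  | add φ ψ h1 h2 =>
    have p1 := φ.size_pos
    have p2 := ψ.size_pos
    simp only [size, eval] at hφ ⊢
    -- Descend into an argument that is still larger than `t`; the search ends at a gate both of
    -- whose arguments have size at most `t`.
    by_cases hs1 : t < φ.size
    · obtain ⟨α, β, hα, hβ, hαβ, v, hv, h⟩ := h1 hs1
      refine ⟨α, β, hα, hβ, hαβ, v, hv, Or.inr ?_⟩
      rcases h with ⟨h, e⟩ | ⟨A, B, hA, hB, e⟩
      -- The leaf `1` is paid for by the leaves of `ψ`, which lie outside the gate.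
      · refine ⟨const 1, ψ, ?_, by omega, ?_⟩
        · simp only [size]; omega
        · simp [eval, e]
      · refine ⟨A, add B ψ, by omega, by simp only [size]; omega, ?_⟩
        simp only [eval, e]; ring
    by_cases hs2 : t < ψ.size
    · obtain ⟨α, β, hα, hβ, hαβ, v, hv, h⟩ := h2 hs2
      refine ⟨α, β, hα, hβ, hαβ, v, hv, Or.inr ?_⟩
      rcases h with ⟨h, e⟩ | ⟨A, B, hA, hB, e⟩
      · refine ⟨const 1, φ, ?_, by omega, ?_⟩
        · simp only [size]; omega
        · simp [eval, e, add_comm]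
      · refine ⟨A, add B φ, by omega, by simp only [size]; omega, ?_⟩
        simp only [eval, e]; ring
    · exact ⟨φ, ψ, by omega, by omega, hφ, _, Or.inl rfl, Or.inl ⟨rfl, rfl⟩⟩
  | mul φ ψ h1 h2 =>
    have p1 := φ.size_pos
    have p2 := ψ.size_pos
    simp only [size, eval] at hφ ⊢
    by_cases hs1 : t < φ.size
    · obtain ⟨α, β, hα, hβ, hαβ, v, hv, h⟩ := h1 hs1
      refine ⟨α, β, hα, hβ, hαβ, v, hv, Or.inr ?_⟩
      rcases h with ⟨h, e⟩ | ⟨A, B, hA, hB, e⟩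
      · refine ⟨ψ, const 0, by omega, ?_, ?_⟩
        · simp only [size]; omega
        · simp [eval, e, mul_comm]
      -- Duplicating `ψ` is harmless, because the sizes of the two coefficients are bounded
      -- separately.
      · refine ⟨mul A ψ, mul B ψ, by simp only [size]; omega, by simp only [size]; omega, ?_⟩
        simp only [eval, e]; ring
    by_cases hs2 : t < ψ.size
    · obtain ⟨α, β, hα, hβ, hαβ, v, hv, h⟩ := h2 hs2
      refine ⟨α, β, hα, hβ, hαβ, v, hv, Or.inr ?_⟩
      rcases h with ⟨h, e⟩ | ⟨A, B, hA, hB, e⟩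
      · refine ⟨φ, const 0, by omega, ?_, ?_⟩
        · simp only [size]; omega
        · simp [eval, e]
      · refine ⟨mul A φ, mul B φ, by simp only [size]; omega, by simp only [size]; omega, ?_⟩
        simp only [eval, e]; ring
    · exact ⟨φ, ψ, by omega, by omega, hφ, _, Or.inr rfl, Or.inl ⟨rfl, rfl⟩⟩

/-- The degree of a formula is at most its size. -/
theorem totalDegree_eval_le (φ : ArithFormula F V) : φ.eval.totalDegree ≤ φ.size := by
  induction φ with
  | const c => simp [eval]
  | var x => simp [eval, size]
  | add φ ψ h1 h2 =>
    refine (MvPolynomial.totalDegree_add _ _).trans (max_le ?_ ?_) <;> simp only [size] <;> omega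
  | mul φ ψ h1 h2 =>
    refine (MvPolynomial.totalDegree_mul _ _).trans ?_
    simp only [size]
    omega

end ArithFormula

theorem Nat.log_mul_le_log {q x s : ℕ} (hq : 1 < q) (hx : 0 < x) (h : x * q ≤ s) :
    Nat.log q x + 1 ≤ Nat.log q s := by
  have hs : s ≠ 0 := by
    have := Nat.mul_pos hx (by omega : 0 < q)
    omega
  rw [Nat.le_log_iff_pow_le hq hs, pow_succ]
  exact (Nat.mul_le_mul_right _ (Nat.pow_log_le_self q hx.ne')).trans h

variable {F K W : Type*} [Field F] [DecidableEq K]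

/-- The hypothesis says `size ≤ (q / (q - 1)) ^ k`, so `k` counts how often a fraction `1/q` of the
leaves can be removed. Each level uses at most two multiplications, `α * β` and `A * v`, which
explains the base `2 * k + 1`. The factor `2 ^ log_q size` pays for having two coefficients `A` and
`B`. -/
theorem ArithFormula.hasLogSums {q : ℕ} (hq : 3 ≤ q) (k : ℕ) :
    ∀ φ : ArithFormula F (K × W), φ.size * (q - 1) ^ k ≤ q ^ k →
      HasLogSums (φ.size * 2 ^ Nat.log q φ.size) (2 * k + 1) φ.eval := by
  induction k with
  | zero =>
    intro φ hφ
    simp only [pow_zero, mul_one] at hφ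
    have h1 : φ.size = 1 := le_antisymm hφ φ.size_pos
    have := hasLogSums_of_totalDegree_le_one (φ.totalDegree_eval_le.trans h1.le)
    simpa [h1] using this
  | succ k ih =>
    intro φ hφ
    rcases Nat.lt_or_ge 1 φ.size with h1 | h1
    swap
    · have h1 : φ.size = 1 := le_antisymm h1 φ.size_pos
      have := hasLogSums_of_totalDegree_le_one (φ.totalDegree_eval_le.trans h1.le)
      rw [h1]
      exact this.mono (by simp) (by omega)
    set s := φ.size with hs
    have hdiv : s / q * q ≤ s := Nat.div_mul_le_self s q
    have hdiv' : s < (s / q + 1) * q := by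
      rw [← Nat.div_lt_iff_lt_mul (by omega)]
      exact Nat.lt_succ_self _
    have hq3 : s / q ≤ s / 3 := Nat.div_le_div_left hq (by norm_num)
    generalize s / q = m at hdiv hdiv' hq3
    obtain ⟨r, rfl⟩ : ∃ r, q = r + 1 := ⟨q - 1, by omega⟩
    simp only [Nat.add_sub_cancel] at ih hφ
    -- Here `m = ⌊s / q⌋`, so at least `m + 1 > s / q` leaves are lost, and that lowers the level by
    -- one.
    have small : ∀ ψ : ArithFormula F (K × W), ψ.size ≤ s - 1 - m →
        HasLogSums (ψ.size * 2 ^ Nat.log (r + 1) ψ.size) (2 * k + 1) ψ.eval := by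
      intro ψ hψ
      refine ih ψ ?_
      have h2 : ψ.size * (r + 1) ≤ s * r := by
        have h3 : ψ.size + (m + 1) ≤ s := by omega
        have h4 := Nat.mul_le_mul_right (r + 1) h3
        rw [add_mul] at h4
        nlinarith
      have h5 : (ψ.size * r ^ k) * (r + 1) ≤ (r + 1) ^ k * (r + 1) := by
        calc (ψ.size * r ^ k) * (r + 1) = (ψ.size * (r + 1)) * r ^ k := by ring
          _ ≤ (s * r) * r ^ k := Nat.mul_le_mul_right _ h2
          _ = s * r ^ (k + 1) := by ring
          _ ≤ (r + 1) ^ (k + 1) := hφ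
          _ = _ := pow_succ _ _
      exact Nat.le_of_mul_le_mul_right h5 (by omega)
    obtain ⟨α, β, hα, hβ, hαβ, v, hv, h⟩ :=
      φ.exists_affine_decomposition (t := s - 1 - m) (by omega) (by omega)
    have bound : ∀ ψ : ArithFormula F (K × W), ψ.size ≤ s →
        ψ.size * 2 ^ Nat.log (r + 1) ψ.size ≤ ψ.size * 2 ^ Nat.log (r + 1) s := fun ψ hψ =>
      Nat.mul_le_mul_left _ (Nat.pow_le_pow_right (by norm_num) (Nat.log_mono_right hψ))
    have hvS : HasLogSums ((α.size + β.size) * 2 ^ Nat.log (r + 1) s) (2 * k + 1 + 1) v := by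
      rw [add_mul]
      have ha := (small α hα).mono (bound α (by omega)) le_rfl
      have hb := (small β hβ).mono (bound β (by omega)) le_rfl
      rcases hv with rfl | rfl
      · exact (ha.add hb).mono le_rfl (by omega)
      · exact ha.mul hb
    rcases h with ⟨h, e⟩ | ⟨A, B, hA, hB, e⟩
    · rw [e, hs, h]
      rw [hs, h] at hvS
      exact hvS.mono le_rfl (by omega)
    · rw [e]
      -- The threshold `s - 1 - m` leaves at most `m ≤ s / q` leaves outside the gate; `3 ≤ q` makes
      -- this small enough for the induction hypothesis to apply to `A` and `B`.
      set x := s - (α.size + β.size) with hx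
      have hxs : x ≤ m := by omega
      have hxq : x * (r + 1) ≤ s := (Nat.mul_le_mul_right _ hxs).trans hdiv
      have hApos := A.size_pos
      have hlog := Nat.log_mul_le_log (by omega : 1 < r + 1) (by omega : 0 < x) hxq
      have hsmall : m ≤ s - 1 - m := by omega
      have cheap : ∀ ψ : ArithFormula F (K × W), ψ.size ≤ x →
          HasLogSums (x * 2 ^ Nat.log (r + 1) x) (2 * k + 1) ψ.eval := fun ψ hψ =>
        (small ψ (by omega)).mono
          (Nat.mul_le_mul hψ (Nat.pow_le_pow_right (by norm_num) (Nat.log_mono_right hψ))) le_rfl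
      have hprod := (((cheap A (by omega)).mono le_rfl (Nat.le_succ _)).mul hvS).add
        ((cheap B (by omega)).mono le_rfl (by omega : 2 * k + 1 ≤ 2 * k + 1 + 1 + 1))
      refine hprod.mono ?_ (by omega)
      -- Passing from `s` to `x ≤ s / q` lowers the logarithm by one, which absorbs the factor 2
      -- coming from `A` and `B`.
      have h2 : 2 * 2 ^ Nat.log (r + 1) x ≤ 2 ^ Nat.log (r + 1) s := by
        rw [← pow_succ']
        exact Nat.pow_le_pow_right (by norm_num) hlog
      have h3 : s = x + (α.size + β.size) := by omega
      calc _ = x * (2 * 2 ^ Nat.log (r + 1) x) + (α.size + β.size) * 2 ^ Nat.log (r + 1) s := by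
            ring
        _ ≤ x * 2 ^ Nat.log (r + 1) s + (α.size + β.size) * 2 ^ Nat.log (r + 1) s := by gcongr
        _ = s * 2 ^ Nat.log (r + 1) s := by rw [← add_mul, ← h3]

end FormulaDecomposition

/-! ### PT-rank of log-products -/

section PTRank

open Finset

variable {F : Type*} {n d : ℕ}

theorem partialTranspose_partialTranspose (κ : Finset (Fin d))
    (M : Matrix (Fin d → Fin n) (Fin d → Fin n) F) :
    partialTranspose κ (partialTranspose κ M) = M := by
  ext i j
  simp only [partialTranspose]
  congr 1 <;> ext k <;> split_ifs <;> rfl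

variable [Field F]

theorem partialTranspose_sum {ι : Type*} (s : Finset ι) (κ : Finset (Fin d))
    (M : ι → Matrix (Fin d → Fin n) (Fin d → Fin n) F) :
    partialTranspose κ (∑ a ∈ s, M a) = ∑ a ∈ s, partialTranspose κ (M a) := by
  ext i j
  simp only [partialTranspose, Matrix.sum_apply]

/-- `M` is a sum of at most `r` matrices with a partial transpose of rank at most one. -/
def IsPTSum (r : ℕ) (M : Matrix (Fin d → Fin n) (Fin d → Fin n) F) : Prop :=
  ∃ l : List (Matrix (Fin d → Fin n) (Fin d → Fin n) F), l.length ≤ r ∧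
    (∀ P ∈ l, ∃ κ : Finset (Fin d), (partialTranspose κ P).rank ≤ 1) ∧ l.sum = M

theorem IsPTSum.mono {r r' : ℕ} (h : r ≤ r') {M : Matrix (Fin d → Fin n) (Fin d → Fin n) F}
    (hM : IsPTSum r M) : IsPTSum r' M :=
  let ⟨l, hl, h1, h2⟩ := hM
  ⟨l, hl.trans h, h1, h2⟩

theorem IsPTSum.add {a b : ℕ} {M N : Matrix (Fin d → Fin n) (Fin d → Fin n) F}
    (hM : IsPTSum a M) (hN : IsPTSum b N) : IsPTSum (a + b) (M + N) := by
  obtain ⟨l, hl, h1, rfl⟩ := hM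
  obtain ⟨m, hm, h2, rfl⟩ := hN
  refine ⟨l ++ m, by simp; omega, ?_, by simp⟩
  intro h hh
  rcases List.mem_append.1 hh with hh | hh
  exacts [h1 h hh, h2 h hh]

theorem IsPTSum.zero (r : ℕ) : IsPTSum r (0 : Matrix (Fin d → Fin n) (Fin d → Fin n) F) :=
  ⟨[], Nat.zero_le _, by simp, rfl⟩

/-- PT-basic matrices have a partial transpose of rank exactly one, so the zero summands must be
discarded. -/
theorem IsPTSum.ptRank_le {r : ℕ} {M : Matrix (Fin d → Fin n) (Fin d → Fin n) F}
    (hM : IsPTSum r M) : ptRank M ≤ r := by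
  classical
  obtain ⟨l, hl, h1, rfl⟩ := hM
  set m := l.filter fun P => P ≠ 0 with hm
  have hsum : m.sum = l.sum := by
    rw [hm]
    clear hm m h1 hl
    induction l with
    | nil => rfl
    | cons P l ih =>
      by_cases hP : P = 0
      · simpa [hP] using ih
      · simp only [ne_eq, hP, not_false_eq_true, decide_true, List.filter_cons_of_pos,
          List.sum_cons]
        rw [← ih]
  have hlen : m.length ≤ r := (List.length_filter_le _ _).trans hl
  refine (Nat.sInf_le (m := m.length) ?_).trans hlen
  refine ⟨fun s => m.get s, fun s => ?_, ?_⟩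
  · have hs := List.mem_filter.1 (List.get_mem m s)
    obtain ⟨κ, hκ⟩ := h1 _ hs.1
    refine ⟨κ, le_antisymm hκ (Nat.one_le_iff_ne_zero.2 fun h0 => ?_)⟩
    rw [Matrix.rank, Submodule.finrank_eq_zero, LinearMap.range_eq_bot] at h0
    have h0 := Matrix.toLin'.map_eq_zero_iff.1 h0
    have : m.get s = 0 := by
      rw [← partialTranspose_partialTranspose κ (m.get s), h0]
      rfl
    exact of_decide_eq_true hs.2 this
  · rw [← hsum, ← List.sum_ofFn, List.ofFn_get]

/-- A matrix whose partial transpose factors through a set of size `r`. -/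
theorem isPTSum_of_partialTranspose_eq {ι : Type*} [Fintype ι] (κ : Finset (Fin d))
    {M : Matrix (Fin d → Fin n) (Fin d → Fin n) F} (a b : ι → (Fin d → Fin n) → F)
    (h : ∀ i j, partialTranspose κ M i j = ∑ w, a w i * b w j) :
    IsPTSum (Fintype.card ι) M := by
  refine ⟨Finset.univ.toList.map fun w => partialTranspose κ (Matrix.vecMulVec (a w) (b w)),
    by simp, ?_, ?_⟩
  · simp only [List.mem_map]
    rintro _ ⟨w, -, rfl⟩
    refine ⟨κ, ?_⟩
    rw [partialTranspose_partialTranspose]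
    exact Matrix.rank_vecMulVec_le _ _
  · rw [Finset.sum_map_toList, ← partialTranspose_sum, ← partialTranspose_partialTranspose κ M]
    congr 1
    ext i j
    rw [h, Matrix.sum_apply]
    rfl

/-- The values of a map on a path can be coloured with two colours in such a way that the colour
changes at least as often as the map takes a new value. -/
theorem exists_two_coloring {ι : Type*} [DecidableEq ι] : ∀ (d : ℕ) (p : Fin (d + 1) → ι),
    ∃ c : ι → Bool, (univ.image p).card ≤
      (univ.filter fun k : Fin d => c (p k.castSucc) ≠ c (p k.succ)).card + 1
  | 0, p => ⟨fun _ => true, by simp⟩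
  | d + 1, p => by
    obtain ⟨c, hc⟩ := exists_two_coloring d fun k => p k.castSucc
    have himage : univ.image p =
        insert (p (Fin.last _)) (univ.image fun k : Fin (d + 1) => p k.castSucc) := by
      ext x
      simp only [mem_image, mem_univ, true_and, mem_insert, Fin.exists_fin_succ', or_comm,
        eq_comm (b := x)]
    by_cases hmem : p (Fin.last _) ∈ univ.image fun k : Fin (d + 1) => p k.castSucc
    · refine ⟨c, ?_⟩
      rw [himage, insert_eq_of_mem hmem]
      refine hc.trans ?_
      rw [card_filter, card_filter, Fin.sum_univ_castSucc]
      simp only [Fin.succ_castSucc]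
      omega
    -- A new value at the end of the path receives the colour opposite to its predecessor's. It does
    -- not occur earlier, so no earlier colour is altered.
    · refine ⟨Function.update c (p (Fin.last _)) (!c (p (Fin.last d).castSucc)), ?_⟩
      have hne : ∀ k : Fin (d + 1), p k.castSucc ≠ p (Fin.last _) := fun k h =>
        hmem (mem_image.2 ⟨k, mem_univ _, h⟩)
      rw [himage, card_insert_of_notMem hmem]
      rw [card_filter, Fin.sum_univ_castSucc]
      rw [card_filter] at hc
      simp only [Fin.succ_castSucc, Function.update_of_ne (hne _), Fin.succ_last,
        Function.update_self] at hc ⊢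
      simpa using hc

/-- The indices of the variables in the monomial of `qTilde` with coefficient `M i j`. -/
def shiftIndex (i j : Fin d → Fin n) (k : Fin (d + 1)) : Option (Fin n) × Option (Fin n) :=
  (Fin.cons (α := fun _ => Option (Fin n)) none (fun l => some (j l)) k,
    Fin.snoc (α := fun _ => Option (Fin n)) (fun l => some (i l)) none k)

theorem shiftIndex_eq {i j i' j' : Fin d → Fin n} {k : Fin (d + 1)}
    (h1 : ∀ l : Fin d, k = l.succ → j l = j' l) (h2 : ∀ l : Fin d, k = l.castSucc → i l = i' l) :
    shiftIndex i j k = shiftIndex i' j' k := by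
  refine Prod.ext ?_ ?_
  · simp only [shiftIndex]
    cases k using Fin.cases with
    | zero => rfl
    | succ l => simp [h1 l rfl]
  · simp only [shiftIndex]
    cases k using Fin.lastCases with
    | last => simp
    | cast l => simp [h2 l rfl]

/-- If the coefficients of the matrix are a product over two colour classes of blocks, its PT-rank
is small when many of the `d` pairs of consecutive blocks have different colours. -/
theorem isPTSum_of_two_coloring {M : Matrix (Fin d → Fin n) (Fin d → Fin n) F}
    (c : Fin (d + 1) → Bool) {A B : (Fin (d + 1) → Option (Fin n) × Option (Fin n)) → F}
    (hA : DependsOn A {k | c k = true}) (hB : DependsOn B {k | c k = false})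
    (hM : ∀ i j, M i j = A (shiftIndex i j) * B (shiftIndex i j)) :
    IsPTSum (n ^ (d - (univ.filter fun k : Fin d => c k.castSucc ≠ c k.succ).card)) M := by
  classical
  -- The index `i k` is read by block `k.castSucc` and `j k` by block `k.succ`. Swapping on `κ`
  -- puts, at every colour change, the index read by `A` into the row and the index read by `B` into
  -- the column.
  set κ : Finset (Fin d) := univ.filter fun k => c k.castSucc = false ∧ c k.succ = true with hκ
  let X : (Fin d → Fin n) → (Fin d → Fin n) → Fin (d + 1) → Option (Fin n) × Option (Fin n) :=
    fun r s => shiftIndex (fun k => if k ∈ κ then s k else r k) (fun k => if k ∈ κ then r k else s k)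
  let N := {k : Fin d // c k.castSucc = c k.succ}
  let ext : (N → Fin n) → (Fin d → Fin n) → Fin d → Fin n := fun w r k =>
    if h : c k.castSucc = c k.succ then w ⟨k, h⟩ else r k
  have hcard : Fintype.card (N → Fin n) =
      n ^ (d - (univ.filter fun k : Fin d => c k.castSucc ≠ c k.succ).card) := by
    rw [Fintype.card_fun, Fintype.card_fin, Fintype.card_subtype]
    congr 1
    have := card_filter_add_card_filter_not (s := (univ : Finset (Fin d)))
      (p := fun k : Fin d => c k.castSucc = c k.succ)
    rw [card_univ, Fintype.card_fin] at this
    simp only [ne_eq]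
    omega
  rw [← hcard]
  -- At a pair of colour `true` the factor `A` needs the column index, so the guess is verified by
  -- the column factor; at a pair of colour `false` the roles are exchanged.
  refine isPTSum_of_partialTranspose_eq κ
    (fun w r => A (X r (ext w r)) *
      if ∀ k : N, c k.1.castSucc = false → r k.1 = w k then 1 else 0)
    (fun w s => B (X (ext w s) s) *
      if ∀ k : N, c k.1.castSucc = true → s k.1 = w k then 1 else 0) ?_
  intro r s
  have hAX : ∀ s', (∀ k : N, c k.1.castSucc = true → s k.1 = s' k.1) → A (X r s) = A (X r s') := by
    intro s' h
    refine hA fun k hk => shiftIndex_eq ?_ ?_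
    · rintro l rfl
      by_cases hl : l ∈ κ
      · simp [hl]
      · simp only [hl, if_false]
        simp only [Set.mem_ofPred_eq] at hk
        simp only [hκ, mem_filter, mem_univ, true_and, hk, and_true, Bool.not_eq_false] at hl
        exact h ⟨l, by rw [hl, hk]⟩ hl
    · rintro l rfl
      simp only [Set.mem_ofPred_eq] at hk
      simp [hκ, hk]
  have hBX : ∀ r', (∀ k : N, c k.1.castSucc = false → r k.1 = r' k.1) →
      B (X r s) = B (X r' s) := by
    intro r' h
    refine hB fun k hk => shiftIndex_eq ?_ ?_
    · rintro l rfl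
      simp only [Set.mem_ofPred_eq] at hk
      simp [hκ, hk]
    · rintro l rfl
      by_cases hl : l ∈ κ
      · simp [hl]
      · simp only [hl, if_false]
        simp only [Set.mem_ofPred_eq] at hk
        simp only [hκ, mem_filter, mem_univ, true_and, hk, Bool.not_eq_true] at hl
        exact h ⟨l, by rw [hl, hk]⟩ hk
  have hN : partialTranspose κ M r s = A (X r s) * B (X r s) := hM _ _
  -- The only guess that passes both tests.
  let w₀ : N → Fin n := fun k => if c k.1.castSucc = true then s k.1 else r k.1
  rw [hN, Finset.sum_eq_single w₀]
  · rw [hAX (ext w₀ r), hBX (ext w₀ s), if_pos, if_pos, mul_one, mul_one]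
    · intro k hk
      simp only [w₀, hk, if_true]
    · intro k hk
      simp only [w₀, hk, Bool.false_eq_true, if_false]
    · rintro ⟨k, hk'⟩ hk
      simp only [ext, w₀, dif_pos hk', hk, Bool.false_eq_true, if_false]
    · rintro ⟨k, hk'⟩ hk
      simp only [ext, w₀, dif_pos hk', hk, if_true]
  · intro w _ hw
    by_contra hne
    apply hw
    simp only [mul_ite, mul_one, mul_zero, ite_eq_right_iff, ite_mul, zero_mul] at hne
    push Not at hne
    ext k
    congr 1
    simp only [w₀]
    rcases h : c k.1.castSucc with _ | _
    · simpa [h] using (hne.2.1 k h).symm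
    · simpa [h] using (hne.1 k h).symm
  · simp

/-- With `p` parts on `d + 1` blocks one has `d + 1 ≤ 2 ^ (p - 1)`, and colouring the parts along
the path gives at least `p - 1` colour changes. -/
theorem IsLogProduct.isPTSum {M : Matrix (Fin d → Fin n) (Fin d → Fin n) F} (hn : 0 < n)
    {f : (Fin (d + 1) → Option (Fin n) × Option (Fin n)) → F} (hf : IsLogProduct univ f)
    (hM : ∀ i j, M i j = f (shiftIndex i j)) :
    IsPTSum (n ^ (d - Nat.clog 2 (d + 1))) M := by
  classical
  obtain ⟨P, hP, g, hg, rfl⟩ := hf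
  obtain ⟨c, hc⟩ := exists_two_coloring d fun k => P.part k
  have himage : univ.image (fun k => P.part k) = P.parts := by
    ext B
    simp only [mem_image, mem_univ, true_and]
    constructor
    · rintro ⟨k, rfl⟩
      exact P.part_mem.2 (mem_univ _)
    · intro hB
      obtain ⟨k, hk⟩ := P.nonempty_of_mem_parts hB
      exact ⟨k, P.part_eq_of_mem hB hk⟩
  rw [himage] at hc
  have key := isPTSum_of_two_coloring (M := M) (fun k => c (P.part k))
    (A := ∏ B ∈ P.parts.filter fun B => c B = true, g B)
    (B := ∏ B ∈ P.parts.filter fun B => ¬ c B = true, g B) ?_ ?_ ?_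
  · refine key.mono (Nat.pow_le_pow_right hn (Nat.sub_le_sub_left ?_ _))
    rw [Nat.clog_le_iff_le_pow (by norm_num)]
    rw [card_univ, Fintype.card_fin] at hP
    exact hP.trans (Nat.pow_le_pow_right (by norm_num) (by omega))
  · intro x y hxy
    simp only [Finset.prod_apply]
    refine prod_congr rfl fun B hB => hg B fun k hk => hxy k ?_
    rw [mem_filter] at hB
    simp only [Set.mem_ofPred_eq]
    rw [P.part_eq_of_mem hB.1 hk, hB.2]
  · intro x y hxy
    simp only [Finset.prod_apply]
    refine prod_congr rfl fun B hB => hg B fun k hk => hxy k ?_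
    rw [mem_filter, Bool.not_eq_true] at hB
    simp only [Set.mem_ofPred_eq]
    rw [P.part_eq_of_mem hB.1 hk, hB.2]
  · intro i j
    rw [hM, ← Pi.mul_apply, prod_filter_mul_prod_filter_not]

theorem IsLogSum.isPTSum (hn : 0 < n) {r : ℕ} {M : Matrix (Fin d → Fin n) (Fin d → Fin n) F}
    {f : (Fin (d + 1) → Option (Fin n) × Option (Fin n)) → F} (hf : IsLogSum univ r f)
    (hM : ∀ i j, M i j = f (shiftIndex i j)) :
    IsPTSum (r * n ^ (d - Nat.clog 2 (d + 1))) M := by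
  obtain ⟨l, hl, h1, rfl⟩ := hf
  refine IsPTSum.mono (Nat.mul_le_mul_right _ hl) ?_
  clear hl
  induction l generalizing M with
  | nil =>
    have : M = 0 := by
      ext i j
      simp [hM]
    rw [this]
    exact IsPTSum.zero _
  | cons f l ih =>
    have : M = Matrix.of (fun i j => l.sum (shiftIndex i j)) +
        Matrix.of (fun i j => f (shiftIndex i j)) := by
      ext i j
      simp [hM, add_comm]
    rw [this, List.length_cons, add_mul, one_mul]
    exact (ih (fun h hh => h1 h (List.mem_cons_of_mem _ hh)) fun i j => rfl).add
      ((h1 f List.mem_cons_self).isPTSum hn fun i j => rfl)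

/-! ### Recovering the matrix from the coefficients of its polynomial. -/

theorem shiftIndex_injective : Function.Injective2 (shiftIndex (n := n) (d := d)) := by
  intro i i' j j' h
  constructor
  · ext k
    have := congrArg Prod.snd (congrFun h k.castSucc)
    simp only [shiftIndex, Fin.snoc_castSucc, Option.some.injEq] at this
    rw [this]
  · ext k
    have := congrArg Prod.fst (congrFun h k.succ)
    simp only [shiftIndex, Fin.cons_succ, Option.some.injEq] at this
    rw [this]

theorem blockMonomial_univ_injective {K W : Type*} [Fintype K] [DecidableEq K] :
    Function.Injective (blockMonomial (W := W) (univ : Finset K)) := by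
  classical
  intro x y h
  ext k : 1
  have := DFunLike.congr_fun h (k, x k)
  simp only [blockMonomial_apply, mem_univ, true_and, if_true] at this
  by_contra hne
  rw [if_neg fun h => hne h.symm] at this
  exact one_ne_zero this

theorem blockCoeff_qTilde (M : Matrix (Fin d → Fin n) (Fin d → Fin n) F) (i j : Fin d → Fin n) :
    blockCoeff (qTilde M) univ (shiftIndex i j) = M i j := by
  classical
  have hmon : ∀ i j : Fin d → Fin n, (∏ k : Fin (d + 1), MvPolynomial.X
      (k, Fin.cons (α := fun _ => Option (Fin n)) none (fun l => some (j l)) k,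
        Fin.snoc (α := fun _ => Option (Fin n)) (fun l => some (i l)) none k) :
        MvPolynomial (ShiftVar n d) F) =
      MvPolynomial.monomial (blockMonomial univ (shiftIndex i j)) 1 := by
    intro i j
    rw [blockMonomial, MvPolynomial.monomial_sum_one]
    rfl
  simp only [blockCoeff, qTilde, hmon, MvPolynomial.coeff_sum, MvPolynomial.coeff_C_mul,
    MvPolynomial.coeff_monomial, mul_ite, mul_one, mul_zero]
  rw [Finset.sum_eq_single i, Finset.sum_eq_single j, if_pos rfl]
  · intro j' _ hj
    rw [if_neg fun h => hj (shiftIndex_injective (blockMonomial_univ_injective h)).2]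
  · simp
  · intro i' _ hi
    refine Finset.sum_eq_zero fun j' _ => ?_
    rw [if_neg fun h => hi (shiftIndex_injective (blockMonomial_univ_injective h)).1]
  · simp

theorem ptRank_le_of_formula {q k : ℕ} (hq : 3 ≤ q) (hn : 0 < n)
    {M : Matrix (Fin d → Fin n) (Fin d → Fin n) F} {φ : ArithFormula F (ShiftVar n d)}
    (hφ : φ.eval = qTilde M) (hk : φ.size * (q - 1) ^ k ≤ q ^ k) :
    ptRank M ≤ φ.size * 2 ^ Nat.log q φ.size * (2 * k + 1) ^ (d + 1) *
      n ^ (d - Nat.clog 2 (d + 1)) := by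
  have h := φ.hasLogSums hq k hk univ univ_nonempty
  rw [card_univ, Fintype.card_fin, hφ] at h
  exact (h.isPTSum hn fun i j => (blockCoeff_qTilde M i j).symm).ptRank_le

end PTRank

/-! ### The asymptotic lower bound -/

section LowerBound

open Filter Topology

/-- Ensures that the infimum defining `formulaSize` is attained. -/
theorem exists_formula_eval_eq {F V : Type*} [Field F] (p : MvPolynomial V F) :
    ∃ φ : ArithFormula F V, φ.eval = p := by
  induction p using MvPolynomial.induction_on with
  | C c => exact ⟨.const c, rfl⟩
  | add p q hp hq =>
    obtain ⟨φ, rfl⟩ := hp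
    obtain ⟨ψ, rfl⟩ := hq
    exact ⟨.add φ ψ, rfl⟩
  | mul_X p x hp =>
    obtain ⟨φ, rfl⟩ := hp
    exact ⟨.mul φ (.var x), rfl⟩

theorem exists_formula_size_eq {F V : Type*} [Field F] (p : MvPolynomial V F) :
    ∃ φ : ArithFormula F V, φ.eval = p ∧ φ.size = formulaSize p :=
  Nat.sInf_mem (s := {s : ℕ | ∃ φ : ArithFormula F V, φ.eval = p ∧ φ.size = s})
    (let ⟨φ, hφ⟩ := exists_formula_eval_eq p; ⟨_, φ, hφ, rfl⟩)

theorem formulaSize_le {F V : Type*} [Field F] (φ : ArithFormula F V) :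
    formulaSize φ.eval ≤ φ.size :=
  Nat.sInf_le ⟨φ, rfl, rfl⟩

/-- Since `(1 - 1/q) ^ q ≤ 1/2`, removing the fraction `1/q` repeatedly for `q * (log₂ s + 1)`
rounds exhausts `s` leaves. This supplies the level `k` for a formula of size `s`. -/
theorem mul_pred_pow_le_pow {q : ℕ} (hq : 0 < q) (s : ℕ) :
    s * (q - 1) ^ (q * (Nat.log 2 s + 1)) ≤ q ^ (q * (Nat.log 2 s + 1)) := by
  have h1 : 2 * (q - 1) ^ q ≤ q ^ q := by
    obtain ⟨r, rfl⟩ : ∃ r, q = r + 1 := ⟨q - 1, by omega⟩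
    rw [Nat.add_sub_cancel]
    calc 2 * r ^ (r + 1) = r ^ (r + 1) + r ^ r * r := by ring
      _ ≤ r ^ (r + 1) + r ^ r * (r + 1) := by gcongr; omega
      _ ≤ (r + 1) ^ (r + 1) := by
        -- The two leading terms of the binomial expansion suffice.
        rw [add_pow, Finset.sum_range_succ, Finset.sum_range_succ]
        simp
        omega
  have h2 : s ≤ 2 ^ (Nat.log 2 s + 1) := (Nat.lt_pow_succ_log_self (by norm_num) s).le
  calc s * (q - 1) ^ (q * (Nat.log 2 s + 1))
      ≤ 2 ^ (Nat.log 2 s + 1) * (q - 1) ^ (q * (Nat.log 2 s + 1)) := Nat.mul_le_mul_right _ h2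
    _ = (2 * (q - 1) ^ q) ^ (Nat.log 2 s + 1) := by rw [mul_pow, pow_mul]
    _ ≤ (q ^ q) ^ (Nat.log 2 s + 1) := Nat.pow_le_pow_left h1 _
    _ = _ := by rw [pow_mul]

theorem Nat.cast_log_mul_log_le {b s : ℕ} (hs : s ≠ 0) :
    (Nat.log b s : ℝ) * Real.log b ≤ Real.log s := by
  rcases Nat.eq_zero_or_pos b with rfl | hb
  · simpa using Real.log_natCast_nonneg s
  rw [← Real.log_pow]
  refine Real.log_le_log (by positivity) ?_
  exact_mod_cast Nat.pow_log_le_self b hs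

/-- The logarithm of the upper bound for the PT-rank. -/
theorem log_ptRank_le {F : Type*} [Field F] {n d m : ℕ} (hn : 0 < n) (hm : 2 ≤ m)
    (M : Matrix (Fin d → Fin n) (Fin d → Fin n) F) (hM : 0 < ptRank M) (hd : 0 < d) :
    Real.log (ptRank M) ≤ (1 + 1 / m) * Real.log (formulaSize (qTilde M)) +
      (d + 1) * Real.log (2 * (2 ^ m * (2 * Real.log (formulaSize (qTilde M)) + 1)) + 1) +
      (d - Real.logb 2 d) * Real.log n := by
  obtain ⟨φ, hφ, hs⟩ := exists_formula_size_eq (qTilde M)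
  rw [← hs]
  set s := φ.size with hs'
  have hspos : 0 < s := φ.size_pos
  have hq : 3 ≤ 2 ^ m := by
    have : 2 ^ 2 ≤ 2 ^ m := Nat.pow_le_pow_right (by norm_num) hm
    omega
  have h := ptRank_le_of_formula hq hn hφ (mul_pred_pow_le_pow (q := 2 ^ m) (by omega) s)
  rw [← hs'] at h
  set k := 2 ^ m * (Nat.log 2 s + 1) with hk
  have hlog2 := Real.log_two_gt_d9
  have hlogs : 0 ≤ Real.log s := Real.log_natCast_nonneg s
  have h1 : (Nat.log (2 ^ m) s : ℝ) * Real.log 2 ≤ Real.log s / m := by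
    have := Nat.cast_log_mul_log_le (b := 2 ^ m) hspos.ne'
    rw [Nat.cast_pow, Real.log_pow] at this
    rw [le_div_iff₀ (by positivity)]
    push_cast at this
    linarith
  -- The factor 2 is a convenient bound for `1 / ln 2`.
  have h2 : (Nat.log 2 s : ℝ) ≤ 2 * Real.log s := by
    have := Nat.cast_log_mul_log_le (b := 2) hspos.ne'
    push_cast at this
    nlinarith [(Nat.cast_nonneg (Nat.log 2 s) : (0 : ℝ) ≤ _)]
  have h3 : ((2 * k + 1 : ℕ) : ℝ) ≤ 2 * (2 ^ m * (2 * Real.log s + 1)) + 1 := by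
    rw [hk]
    push_cast
    gcongr
  have hclog : Nat.clog 2 (d + 1) ≤ d := by
    rw [Nat.clog_le_iff_le_pow (by norm_num)]
    exact Nat.lt_two_pow_self
  have h4 : Real.logb 2 d ≤ Nat.clog 2 (d + 1) := by
    rw [Real.logb_le_iff_le_rpow (by norm_num) (by exact_mod_cast hd), Real.rpow_natCast]
    have := Nat.le_pow_clog (b := 2) (by norm_num) (d + 1)
    exact_mod_cast (Nat.le_succ d).trans this
  have hlogn : 0 ≤ Real.log n := Real.log_natCast_nonneg n
  have hn' : (n : ℝ) ≠ 0 := by positivity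
  have hs0 : (s : ℝ) ≠ 0 := by positivity
  calc Real.log (ptRank M) ≤ Real.log ((s * 2 ^ Nat.log (2 ^ m) s * (2 * k + 1) ^ (d + 1) *
        n ^ (d - Nat.clog 2 (d + 1)) : ℕ)) :=
        Real.log_le_log (by exact_mod_cast hM) (by exact_mod_cast h)
    _ = Real.log s + Nat.log (2 ^ m) s * Real.log 2 + (d + 1) * Real.log (2 * k + 1 : ℕ) +
        (d - Nat.clog 2 (d + 1)) * Real.log n := by
        push_cast
        rw [Real.log_mul (by positivity) (by positivity), Real.log_mul (by positivity)
          (by positivity), Real.log_mul (by positivity) (by positivity), Real.log_pow,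
          Real.log_pow, Real.log_pow, Nat.cast_sub hclog]
        push_cast
        ring
    _ ≤ Real.log s + Real.log s / m +
        (d + 1) * Real.log (2 * (2 ^ m * (2 * Real.log s + 1)) + 1) +
        (d - Real.logb 2 d) * Real.log n := by
        gcongr
    _ = _ := by ring

variable {F : Type*} [Field F] {d : ℕ → ℕ}
  {M : ∀ n, Matrix (Fin (d n) → Fin n) (Fin (d n) → Fin n) F}

/-- If the formula size were below `n ^ ((1 - η) log₂ d)`, the upper bound of `log_ptRank_le` would
fall short of the PT-rank by a power of `n` that grows with `log₂ d`. -/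
theorem eventually_rpow_le_formulaSize
    (hd_lower : Tendsto d atTop atTop)
    (hd_upper : (fun n : ℕ => (d n : ℝ)) =O[atTop] (fun n : ℕ => Real.log n / Real.log (Real.log n)))
    {δ : ℕ → ℝ} (hδ : δ =o[atTop] (fun n : ℕ => Real.logb 2 (d n)))
    (hrank : ∀ᶠ n : ℕ in atTop, (ptRank (M n) : ℝ) = (n : ℝ) ^ ((d n : ℝ) - δ n))
    {η : ℝ} (hη : 0 < η) :
    ∀ᶠ n : ℕ in atTop,
      (n : ℝ) ^ ((1 - η) * Real.logb 2 (d n)) ≤ (formulaSize (qTilde (M n)) : ℝ) := by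
  obtain ⟨C, hC0, hC⟩ := hd_upper.exists_pos
  rw [Asymptotics.IsBigOWith] at hC
  -- For `q = 2 ^ m` the overhead `2 ^ log_q s` is at most `s ^ (1/m)`, and `m > 4 / η` makes `1/m`
  -- at most `η / 4`.
  obtain ⟨m, hm⟩ := exists_nat_gt (max 2 (4 / η))
  have hm2 : 2 ≤ m := by
    have := (le_max_left _ _).trans_lt hm
    exact_mod_cast this.le
  have hmη : 1 / (m : ℝ) ≤ η / 4 := by
    have := (le_max_right _ _).trans_lt hm
    rw [div_lt_iff₀ hη] at this
    rw [div_le_div_iff₀ (by positivity) (by norm_num)]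
    linarith
  have hlog : Tendsto (fun n : ℕ => Real.log n) atTop atTop :=
    Real.tendsto_log_atTop.comp tendsto_natCast_atTop_atTop
  have hloglog := Real.tendsto_log_atTop.comp hlog
  have hdR : Tendsto (fun n => (d n : ℝ)) atTop atTop := tendsto_natCast_atTop_atTop.comp hd_lower
  have hL : Tendsto (fun n => Real.logb 2 (d n)) atTop atTop :=
    (Real.tendsto_logb_atTop (by norm_num)).comp hdR
  filter_upwards [hC, hrank, hδ.bound (by positivity : 0 < η / 4), hL.eventually_ge_atTop 1,
    hL.eventually_gt_atTop (16 * C / η), hdR.eventually_ge_atTop 1, eventually_gt_atTop 1,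
    hlog.eventually_ge_atTop (max 1 (max C (2 * (2 ^ m * (2 + 1)) + 1))),
    hloglog.eventually_ge_atTop 1] with n hdC hrank hδ hL1 hLC hd1 hn hlogn hloglogn
  by_contra hlt
  push Not at hlt
  simp only [Function.comp_apply] at hloglogn
  set ℓ := Real.log n with hℓ
  set L := Real.logb 2 (d n) with hLdef
  have hℓ1 : 1 ≤ ℓ := (le_max_left _ _).trans hlogn
  have hℓC : C ≤ ℓ := (le_max_left _ _).trans ((le_max_right _ _).trans hlogn)
  have hℓm : 2 * (2 ^ m * (2 + 1)) + 1 ≤ ℓ := (le_max_right _ _).trans ((le_max_right _ _).trans hlogn)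
  have hnpos : (0 : ℝ) < n := by positivity
  have hdC' : (d n : ℝ) ≤ C * (ℓ / Real.log ℓ) := by
    rw [Real.norm_of_nonneg (by positivity), Real.norm_of_nonneg (by positivity)] at hdC
    exact hdC
  have hdsq : (d n : ℝ) ≤ ℓ ^ 2 := by
    calc (d n : ℝ) ≤ C * (ℓ / Real.log ℓ) := hdC'
      _ ≤ ℓ * ℓ := by
        gcongr
        exact div_le_self (by linarith) hloglogn
      _ = ℓ ^ 2 := by ring
  have hLd : L ≤ d n := by
    rw [hLdef, Real.logb_le_iff_le_rpow (by norm_num) (by linarith), Real.rpow_natCast]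
    exact_mod_cast Nat.lt_two_pow_self.le
  have hrpos : 0 < ptRank (M n) := by
    have : (0 : ℝ) < ptRank (M n) := by
      rw [hrank]
      positivity
    exact_mod_cast this
  have hspos : 0 < formulaSize (qTilde (M n)) := by
    obtain ⟨φ, -, hs⟩ := exists_formula_size_eq (qTilde (M n))
    rw [← hs]
    exact φ.size_pos
  have key := log_ptRank_le (by omega : 0 < n) hm2 (M n) hrpos (by exact_mod_cast hd1)
  rw [hrank, Real.log_rpow hnpos] at key
  have hls : Real.log (formulaSize (qTilde (M n))) ≤ (1 - η) * L * ℓ := by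
    rw [hℓ, ← Real.log_rpow hnpos]
    exact Real.log_le_log (by exact_mod_cast hspos) hlt.le
  set s := Real.log (formulaSize (qTilde (M n))) with hs
  have hs0 : 0 ≤ s := Real.log_natCast_nonneg _
  rw [← hℓ, ← hLdef] at key
  have hδ' : δ n ≤ η / 4 * L := by
    rw [Real.norm_of_nonneg (by linarith : 0 ≤ L)] at hδ
    exact (le_abs_self _).trans hδ
  have hs3 : s ≤ ℓ ^ 3 := by
    calc s ≤ (1 - η) * L * ℓ := hls
      _ = (1 - η) * (L * ℓ) := by ring
      _ ≤ 1 * (L * ℓ) := by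
        gcongr
        linarith
      _ ≤ 1 * (ℓ ^ 2 * ℓ) := by
        gcongr
        linarith
      _ = ℓ ^ 3 := by ring
  have hlog4 : Real.log (2 * (2 ^ m * (2 * s + 1)) + 1) ≤ 4 * Real.log ℓ := by
    have h1 : 1 ≤ ℓ ^ 3 := one_le_pow₀ hℓ1
    have : 2 * (2 ^ m * (2 * s + 1)) + 1 ≤ ℓ ^ 4 := by
      calc 2 * (2 ^ m * (2 * s + 1)) + 1 ≤ 2 * (2 ^ m * (2 * ℓ ^ 3 + ℓ ^ 3)) + ℓ ^ 3 := by gcongr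
        _ = (2 * (2 ^ m * (2 + 1)) + 1) * ℓ ^ 3 := by ring
        _ ≤ ℓ * ℓ ^ 3 := by gcongr
        _ = ℓ ^ 4 := by ring
    calc _ ≤ Real.log (ℓ ^ 4) := Real.log_le_log (by positivity) this
      _ = 4 * Real.log ℓ := by rw [Real.log_pow]; norm_num
  -- The upper bound on `d` is essential here: its denominator `log log n` cancels the `log ℓ` of
  -- the other factor.
  have hsecond : (d n + 1) * Real.log (2 * (2 ^ m * (2 * s + 1)) + 1) ≤ 8 * C * ℓ := by
    have hnonneg : 0 ≤ Real.log (2 * (2 ^ m * (2 * s + 1)) + 1) :=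
      Real.log_nonneg (le_add_of_nonneg_left (by positivity))
    calc _ ≤ (2 * (C * (ℓ / Real.log ℓ))) * (4 * Real.log ℓ) := by
          gcongr
          linarith
      _ = 8 * C * ℓ := by
          field_simp
          ring
  have hfirst : (1 + 1 / m) * s ≤ (1 - 3 * η / 4) * (L * ℓ) := by
    have hLℓ : 0 ≤ L * ℓ := by positivity
    have h0 : 0 ≤ (1 - η) * (L * ℓ) := by linarith
    calc (1 + 1 / m) * s ≤ (1 + η / 4) * ((1 - η) * (L * ℓ)) := by
          gcongr
          linarith
      _ ≤ (1 - 3 * η / 4) * (L * ℓ) := by nlinarith [sq_nonneg η]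
  have hδℓ : δ n * ℓ ≤ η / 4 * L * ℓ := by gcongr
  -- Of the gap `L`, the defect `δ` uses up `η / 4 * L` and the formula size `(1 - 3 * η / 4) * L`;
  -- the remaining `η / 2 * L` would have to be bounded.
  have hfin : η / 2 * L * ℓ ≤ 8 * C * ℓ := by linarith
  have := le_of_mul_le_mul_right hfin (by linarith)
  rw [div_lt_iff₀ hη] at hLC
  linarith

/-- Solving for the error term gives `1 - log_n (formulaSize) / log₂ d`. Its positive part is taken
because the formula size may exceed `n ^ log₂ d`. -/
theorem exists_rpow_le_formulaSize (hd_lower : Tendsto d atTop atTop)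
    (h : ∀ η : ℝ, 0 < η → ∀ᶠ n : ℕ in atTop,
      (n : ℝ) ^ ((1 - η) * Real.logb 2 (d n)) ≤ (formulaSize (qTilde (M n)) : ℝ)) :
    ∃ ε : ℕ → ℝ, Tendsto ε atTop (𝓝 0) ∧ ∀ᶠ n : ℕ in atTop,
      (n : ℝ) ^ ((1 - ε n) * Real.logb 2 (d n)) ≤ (formulaSize (qTilde (M n)) : ℝ) := by
  have hspos : ∀ n, (0 : ℝ) < formulaSize (qTilde (M n)) := by
    intro n
    obtain ⟨φ, -, hs⟩ := exists_formula_size_eq (qTilde (M n))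
    rw [← hs]
    exact_mod_cast φ.size_pos
  have hL : Tendsto (fun n => Real.logb 2 (d n)) atTop atTop :=
    (Real.tendsto_logb_atTop (by norm_num)).comp (tendsto_natCast_atTop_atTop.comp hd_lower)
  refine ⟨fun n => max 0 (1 - Real.logb n (formulaSize (qTilde (M n))) / Real.logb 2 (d n)), ?_, ?_⟩
  · refine tendsto_order.2 ⟨fun a ha => Eventually.of_forall fun n => ha.trans_le (le_max_left _ _),
      fun a ha => ?_⟩
    filter_upwards [h (a / 2) (by linarith), eventually_gt_atTop 1, hL.eventually_gt_atTop 0]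
      with n hn hn1 hL0
    have hn1' : (1 : ℝ) < n := by exact_mod_cast hn1
    rw [← Real.le_logb_iff_rpow_le hn1' (hspos n), ← le_div_iff₀ hL0] at hn
    exact max_lt ha (by linarith)
  · filter_upwards [eventually_gt_atTop 1, hL.eventually_gt_atTop 0] with n hn1 hL0
    have hn1' : (1 : ℝ) < n := by exact_mod_cast hn1
    rw [← Real.le_logb_iff_rpow_le hn1' (hspos n), ← le_div_iff₀ hL0]
    have := le_max_right 0 (1 - Real.logb n (formulaSize (qTilde (M n))) / Real.logb 2 (d n))
    linarith

theorem not_eventually_formulaSize_le (hd_lower : Tendsto d atTop atTop)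
    (h : ∀ η : ℝ, 0 < η → ∀ᶠ n : ℕ in atTop,
      (n : ℝ) ^ ((1 - η) * Real.logb 2 (d n)) ≤ (formulaSize (qTilde (M n)) : ℝ)) (c : ℕ) :
    ¬ ∀ᶠ n : ℕ in atTop, formulaSize (qTilde (M n)) ≤ n ^ c := by
  intro hc
  have hL : Tendsto (fun n => Real.logb 2 (d n)) atTop atTop :=
    (Real.tendsto_logb_atTop (by norm_num)).comp (tendsto_natCast_atTop_atTop.comp hd_lower)
  obtain ⟨n, hc, h, hL, hn⟩ := (hc.and ((h (1 / 2) (by norm_num)).and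
    ((hL.eventually_gt_atTop (2 * c)).and (eventually_gt_atTop 1)))).exists
  have hn1 : (1 : ℝ) < n := by exact_mod_cast hn
  have h2 : (n : ℝ) ^ ((1 - 1 / 2) * Real.logb 2 (d n)) ≤ (n : ℝ) ^ (c : ℝ) := by
    rw [Real.rpow_natCast]
    exact h.trans (by exact_mod_cast hc)
  rw [Real.rpow_le_rpow_left_iff hn1] at h2
  linarith

end LowerBound

/-! ### Straight-line generation of Boolean functions -/

section Generation

variable {X : Type*}

/-- Every entry of the list is constant or a binary Boolean operation applied to elements of `A`
or later entries. -/
def IsStraightLine (A : Set (X → Bool)) : List (X → Bool) → Prop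
  | [] => True
  | f :: L => IsStraightLine A L ∧ ((∃ b, f = fun _ => b) ∨
      ∃ (op : Bool → Bool → Bool) (g h : X → Bool), (g ∈ A ∨ g ∈ L) ∧ (h ∈ A ∨ h ∈ L) ∧
        f = fun x => op (g x) (h x))

/-- All functions in `A'` can be computed from those in `A` by at most `c` Boolean operations. -/
def Generates (A : Set (X → Bool)) (c : ℕ) (A' : Set (X → Bool)) : Prop :=
  ∃ L, IsStraightLine A L ∧ L.length ≤ c ∧ ∀ f ∈ A', f ∈ A ∨ f ∈ L

theorem IsStraightLine.append {A A' : Set (X → Bool)} {L₁ : List (X → Bool)}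
    (h₁ : IsStraightLine A L₁) (hA : ∀ f ∈ A', f ∈ A ∨ f ∈ L₁) :
    ∀ {L₂ : List (X → Bool)}, IsStraightLine A' L₂ → IsStraightLine A (L₂ ++ L₁)
  | [], _ => h₁
  | f :: L₂, h => by
    refine ⟨h₁.append hA h.1, h.2.imp_right ?_⟩
    have key : ∀ g, g ∈ A' ∨ g ∈ L₂ → g ∈ A ∨ g ∈ L₂ ++ L₁ := by
      rintro g (hg | hg)
      · exact (hA g hg).imp_right (List.mem_append_right _)
      · exact Or.inr (List.mem_append_left _ hg)
    rintro ⟨op, g, g', hg, hg', rfl⟩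
    exact ⟨op, g, g', key g hg, key g' hg', rfl⟩

namespace Generates

variable {A A' A'' B : Set (X → Bool)} {a b c : ℕ} {f g : X → Bool}

theorem of_subset (h : A' ⊆ A) : Generates A 0 A' :=
  ⟨[], trivial, le_rfl, fun _ hf => Or.inl (h hf)⟩

theorem of_mem (h : f ∈ A) : Generates A 0 {f} :=
  of_subset (Set.singleton_subset_iff.2 h)

theorem mono (hab : a ≤ b) (h : Generates A a A') : Generates A b A' :=
  let ⟨L, h1, h2, h3⟩ := h
  ⟨L, h1, h2.trans hab, h3⟩

theorem anti (h : Generates A a A') (hA : A'' ⊆ A') : Generates A a A'' :=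
  let ⟨L, h1, h2, h3⟩ := h
  ⟨L, h1, h2, fun f hf => h3 f (hA hf)⟩

theorem trans (h : Generates A a A') (h' : Generates A' b A'') : Generates A (a + b) A'' := by
  obtain ⟨L, h1, h2, h3⟩ := h
  obtain ⟨L', h1', h2', h3'⟩ := h'
  refine ⟨L' ++ L, h1.append h3 h1', by simp; omega, fun f hf => ?_⟩
  rcases h3' f hf with h | h
  · exact (h3 f h).imp_right (List.mem_append_right _)
  · exact Or.inr (List.mem_append_left _ h)

theorem weaken (h : Generates A a A') (hA : A ⊆ B) : Generates B a A' :=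
  ((of_subset hA).trans h).mono (by omega)

theorem union (h : Generates A a A') (h' : Generates A b A'') :
    Generates A (a + b) (A' ∪ A'') := by
  obtain ⟨L, h1, h2, h3⟩ := h
  obtain ⟨L', h1', h2', h3'⟩ := h'
  refine ⟨L' ++ L, h1.append (fun f hf => Or.inl hf) h1', by simp; omega, fun f hf => ?_⟩
  rcases hf with hf | hf
  · exact (h3 f hf).imp_right (List.mem_append_right _)
  · exact (h3' f hf).imp_right (List.mem_append_left _)

theorem biUnion {ι : Type*} (s : Finset ι) {c : ℕ} {f : ι → Set (X → Bool)}
    (h : ∀ i ∈ s, Generates A c (f i)) : Generates A (s.card * c) (⋃ i ∈ s, f i) := by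
  classical
  induction s using Finset.induction_on with
  | empty => exact (of_subset (by simp)).mono (Nat.zero_le _)
  | insert i s hi ih =>
    rw [Finset.set_biUnion_insert, Finset.card_insert_of_notMem hi]
    refine ((h i (Finset.mem_insert_self _ _)).union
      (ih fun j hj => h j (Finset.mem_insert_of_mem hj))).mono (le_of_eq ?_)
    ring

theorem const (A : Set (X → Bool)) (b : Bool) : Generates A 1 {fun _ => b} :=
  ⟨[fun _ => b], ⟨trivial, Or.inl ⟨b, rfl⟩⟩, le_rfl, fun f hf => Or.inr (by simpa using hf)⟩

theorem op (op : Bool → Bool → Bool) (hf : Generates A a {f}) (hg : Generates A b {g}) :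
    Generates A (a + b + 1) {fun x => op (f x) (g x)} :=
  (hf.union hg).trans ⟨[fun x => op (f x) (g x)],
    ⟨trivial, Or.inr ⟨op, f, g, Or.inl (Or.inl rfl), Or.inl (Or.inr rfl), rfl⟩⟩, le_rfl,
    fun h hh => Or.inr (by simpa using hh)⟩

/-- Evaluation of a table at an index that is given by its indicator functions. -/
theorem lookup {I : Type*} [DecidableEq I] (ix : X → I) (s : Finset I) (hs : ∀ x, ix x ∈ s)
    (hA : ∀ i ∈ s, (fun x => decide (ix x = i)) ∈ A) {h : I → X → Bool}
    (hh : ∀ i ∈ s, Generates A c {h i}) :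
    Generates A (s.card * (c + 2) + 1) {fun x => h (ix x) x} := by
  -- A disjunction of `[ix x = i] ∧ h i x` over `i ∈ t`: every index costs `c` operations and two
  -- connectives, and the empty disjunction is one constant.
  have key : ∀ t ⊆ s, Generates A (t.card * (c + 2) + 1)
      {fun x => decide (ix x ∈ t) && h (ix x) x} := by
    intro t ht
    induction t using Finset.induction_on with
    | empty => simpa using const A false
    | insert i t hi ih =>
      rw [Finset.insert_subset_iff] at ht
      have := (ih ht.2).op or ((of_mem (hA i ht.1)).op and (hh i ht.1))
      rw [Finset.card_insert_of_notMem hi]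
      convert this.mono (b := (t.card + 1) * (c + 2) + 1) (by ring_nf; omega) using 4 with x
      by_cases hx : ix x = i
      · subst hx
        simp [hi]
      · simp [hx]
  simpa [hs] using key s subset_rfl

theorem table {I : Type*} [DecidableEq I] (ix : X → I) (s : Finset I) (hs : ∀ x, ix x ∈ s)
    (hA : ∀ i ∈ s, (fun x => decide (ix x = i)) ∈ A) (h : I → Bool) :
    Generates A (s.card * 3 + 1) {fun x => h (ix x)} :=
  lookup (h := fun i _ => h i) ix s hs hA fun _ _ => const A _

end Generates

/-! ### Observations -/

variable {α : Type*}

/-- The Boolean functions obtained from the observations in `O` of the value `v x`. -/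
def observe (O : Finset (α → Bool)) (v : X → α) : Set (X → Bool) :=
  {f | ∃ Q ∈ O, f = fun x => Q (v x)}

theorem observe_mono {O O' : Finset (α → Bool)} (h : O ⊆ O') (v : X → α) :
    observe O v ⊆ observe O' v :=
  fun _ ⟨Q, hQ, e⟩ => ⟨Q, h hQ, e⟩

theorem mem_observe {O : Finset (α → Bool)} {v : X → α} {Q : α → Bool} (hQ : Q ∈ O) :
    (fun x => Q (v x)) ∈ observe O v :=
  ⟨Q, hQ, rfl⟩

theorem generates_observe {A : Set (X → Bool)} {O : Finset (α → Bool)} {v : X → α} {c : ℕ}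
    (h : ∀ Q ∈ O, Generates A c {fun x => Q (v x)}) :
    Generates A (O.card * c) (observe O v) := by
  refine (Generates.biUnion O h).anti ?_
  rintro f ⟨Q, hQ, rfl⟩
  simp only [Set.mem_iUnion]
  exact ⟨Q, hQ, rfl⟩

variable [DecidableEq α]

/-- The observations of the symbols from `G` at the first `P` positions of a list. -/
noncomputable def listObs (G : Finset α) (P : ℕ) : Finset (List α → Bool) :=
  open Classical in
  (Finset.range P ×ˢ Finset.insertNone G).image fun q L => decide (L[q.1]? = q.2)

theorem card_listObs_le (G : Finset α) (P : ℕ) : (listObs G P).card ≤ P * (G.card + 1) := by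
  classical
  refine Finset.card_image_le.trans ?_
  simp

theorem mem_listObs {G : Finset α} {P p : ℕ} (hp : p < P) {o : Option α}
    (ho : o ∈ Finset.insertNone G) : (fun L : List α => decide (L[p]? = o)) ∈ listObs G P := by
  classical exact Finset.mem_image.2 ⟨(p, o), by simp [hp, ho], rfl⟩

theorem exists_of_mem_listObs {G : Finset α} {P : ℕ} {Q : List α → Bool} (hQ : Q ∈ listObs G P) :
    ∃ p < P, ∃ o ∈ Finset.insertNone G, Q = fun L => decide (L[p]? = o) := by
  classical
  obtain ⟨⟨p, o⟩, h, rfl⟩ := Finset.mem_image.1 hQ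
  simp only [Finset.mem_product, Finset.mem_range] at h
  exact ⟨p, h.1, o, h.2, rfl⟩

theorem listObs_mono (G : Finset α) {P P' : ℕ} (h : P ≤ P') : listObs G P ⊆ listObs G P' := by
  classical
  intro Q hQ
  obtain ⟨p, hp, o, ho, rfl⟩ := exists_of_mem_listObs hQ
  exact mem_listObs (hp.trans_le h) ho

/-! ### Encodings as lists -/

theorem generates_listObs_nil (A : Set (X → Bool)) (G : Finset α) (P : ℕ) :
    Generates A (P * (G.card + 1)) (observe (listObs G P) fun _ : X => ([] : List α)) :=
  (generates_observe fun Q _ => Generates.const A (Q [])).mono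
    (by rw [mul_one]; exact card_listObs_le G P)

/-- The words have different lengths, so the position in `ℓ` that is looked at depends on `a x`. For
each fixed value of `a x` it is known, and a lookup over the `n` values combines the cases. -/
theorem Generates.listObs_append {A : Set (X → Bool)} {G : Finset α} {P c n : ℕ}
    (word : Fin n → List α) (a : X → Fin n) (ha : ∀ i, (fun x => decide (a x = i)) ∈ A)
    {ℓ : X → List α} (h : Generates A c (observe (listObs G P) ℓ)) :
    Generates A (c + P * (G.card + 1) * (n * 3 + 1))
      (observe (listObs G P) fun x => word (a x) ++ ℓ x) := by
  have hAB : Generates A c (A ∪ observe (listObs G P) ℓ) :=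
    ((of_subset subset_rfl).union h).mono (by omega)
  refine (hAB.trans (generates_observe (c := n * 3 + 1) fun Q hQ => ?_)).mono
    (Nat.add_le_add_left (Nat.mul_le_mul_right _ (card_listObs_le G P)) _)
  obtain ⟨p, hp, o, ho, rfl⟩ := exists_of_mem_listObs hQ
  have := Generates.lookup (A := A ∪ observe (listObs G P) ℓ) (c := 1) a Finset.univ (by simp)
    (fun i _ => Or.inl (ha i))
    (h := fun i x => decide ((word i ++ ℓ x)[p]? = o)) fun i _ => ?_
  · simpa using this
  · by_cases hpi : p < (word i).length
    · simp only [List.getElem?_append_left hpi]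
      exact Generates.const _ _
    · simp only [List.getElem?_append_right (not_lt.1 hpi)]
      exact (of_mem (Or.inr (mem_observe (mem_listObs (by omega) ho)))).mono (Nat.zero_le _)

theorem generates_listObs_flatMap {A : Set (X → Bool)} (G : Finset α) (P : ℕ) {n : ℕ}
    (word : Fin n → List α) (l : List (X → Fin n))
    (hl : ∀ a ∈ l, ∀ i, (fun x => decide (a x = i)) ∈ A) :
    Generates A ((l.length + 1) * (P * (G.card + 1) * (n * 3 + 1)))
      (observe (listObs G P) fun x => l.flatMap fun a => word (a x)) := by
  induction l with
  | nil =>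
    refine (generates_listObs_nil A G P).mono ?_
    simp only [List.length_nil, zero_add, one_mul]
    exact Nat.le_mul_of_pos_right _ (by omega)
  | cons a l ih =>
    refine ((ih fun b hb => hl b (List.mem_cons_of_mem _ hb)).listObs_append word a
      (hl a List.mem_cons_self)).mono (le_of_eq ?_)
    simp only [List.length_cons]
    ring

end Generation

/-! ### Simulation of stack machines -/

section Simulation

open Turing.TM2 Finset

variable {K : Type*} [Fintype K] {Γ : K → Type*} [∀ k, DecidableEq (Γ k)]
  {Λ : Type*} [DecidableEq Λ] [Fintype Λ] {σ : Type*} [DecidableEq σ] [Fintype σ]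

/-- The observations of the label, the state, and the first `P` symbols of every stack of a
configuration. -/
noncomputable def cfgObs (Λ σ : Type*) [DecidableEq Λ] [Fintype Λ] [DecidableEq σ] [Fintype σ]
    (G : ∀ k, Finset (Γ k)) (P : ℕ) : Finset (Cfg Γ Λ σ → Bool) :=
  open Classical in
  (univ.image fun (l : Option Λ) c => decide (c.l = l)) ∪
    (univ.image fun (u : σ) c => decide (c.var = u)) ∪
    univ.biUnion fun k => (listObs (G k) P).image fun Q c => Q (c.stk k)

/-- The number of observations is at most this factor times `P + 1`. -/
def cfgObsFactor (Λ σ : Type*) [Fintype Λ] [Fintype σ] (G : ∀ k, Finset (Γ k)) : ℕ :=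
  Fintype.card Λ + 1 + Fintype.card σ + ∑ k, ((G k).card + 1)

theorem card_cfgObs_le (G : ∀ k, Finset (Γ k)) (P : ℕ) :
    (cfgObs Λ σ G P).card ≤ cfgObsFactor Λ σ G * (P + 1) := by
  classical
  have h1 : ((univ : Finset (Option Λ)).image
      fun l (c : Cfg Γ Λ σ) => decide (c.l = l)).card ≤ Fintype.card Λ + 1 :=
    card_image_le.trans (by simp)
  have h2 : ((univ : Finset σ).image
      fun u (c : Cfg Γ Λ σ) => decide (c.var = u)).card ≤ Fintype.card σ :=
    card_image_le.trans (by simp)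
  have h3 : ((univ : Finset K).biUnion fun k => (listObs (G k) P).image
      fun Q (c : Cfg Γ Λ σ) => Q (c.stk k)).card ≤ P * ∑ k, ((G k).card + 1) := by
    rw [mul_sum]
    exact card_biUnion_le.trans
      (sum_le_sum fun k _ => card_image_le.trans (card_listObs_le (G k) P))
  refine (card_union_le _ _).trans ((Nat.add_le_add ((card_union_le _ _).trans
    (Nat.add_le_add h1 h2)) h3).trans ?_)
  have := Nat.zero_le (P * (Fintype.card Λ + 1 + Fintype.card σ))
  unfold cfgObsFactor
  generalize ∑ k, ((G k).card + 1) = b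
  nlinarith

theorem label_mem_cfgObs (G : ∀ k, Finset (Γ k)) (P : ℕ) (l : Option Λ) :
    (fun c : Cfg Γ Λ σ => decide (c.l = l)) ∈ cfgObs Λ σ G P := by
  classical exact mem_union_left _ (mem_union_left _ (mem_image_of_mem _ (mem_univ l)))

theorem var_mem_cfgObs (G : ∀ k, Finset (Γ k)) (P : ℕ) (u : σ) :
    (fun c : Cfg Γ Λ σ => decide (c.var = u)) ∈ cfgObs Λ σ G P := by
  classical exact mem_union_left _ (mem_union_right _ (mem_image_of_mem _ (mem_univ u)))

theorem stk_mem_cfgObs {G : ∀ k, Finset (Γ k)} {P : ℕ} {k : K} {Q : List (Γ k) → Bool}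
    (hQ : Q ∈ listObs (G k) P) : (fun c : Cfg Γ Λ σ => Q (c.stk k)) ∈ cfgObs Λ σ G P := by
  classical exact mem_union_right _ (mem_biUnion.2 ⟨k, mem_univ _, mem_image_of_mem _ hQ⟩)

theorem cfgObs_cases {G : ∀ k, Finset (Γ k)} {P : ℕ} {p : (Cfg Γ Λ σ → Bool) → Prop}
    (hl : ∀ l, p fun c => decide (c.l = l)) (hv : ∀ u, p fun c => decide (c.var = u))
    (hs : ∀ k, ∀ Q ∈ listObs (G k) P, p fun c => Q (c.stk k)) : ∀ Q ∈ cfgObs Λ σ G P, p Q := by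
  classical
  intro Q hQ
  rcases mem_union.1 hQ with hQ | hQ
  · rcases mem_union.1 hQ with hQ | hQ
    · obtain ⟨l, -, rfl⟩ := mem_image.1 hQ
      exact hl l
    · obtain ⟨u, -, rfl⟩ := mem_image.1 hQ
      exact hv u
  · obtain ⟨k, -, hQ⟩ := mem_biUnion.1 hQ
    obtain ⟨Q', hQ', rfl⟩ := mem_image.1 hQ
    exact hs k Q' hQ'

theorem cfgObs_mono (G : ∀ k, Finset (Γ k)) {P P' : ℕ} (h : P ≤ P') :
    cfgObs Λ σ G P ⊆ cfgObs Λ σ G P' :=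
  cfgObs_cases (label_mem_cfgObs G P') (var_mem_cfgObs G P')
    fun k _ hQ => stk_mem_cfgObs (listObs_mono (G k) h hQ)

/-- All symbols on the stacks belong to the sets `G k`. -/
def CfgOver (G : ∀ k, Finset (Γ k)) (c : Cfg Γ Λ σ) : Prop :=
  ∀ k, ∀ g ∈ c.stk k, g ∈ G k

/-- The transition `f` preserves the alphabet, pushes at most `C` symbols, and can be computed with
linearly many Boolean operations. -/
def Simulable (G : ∀ k, Finset (Γ k)) (f : Cfg Γ Λ σ → Cfg Γ Λ σ) (C : ℕ) : Prop :=
  (∀ c, CfgOver G c → CfgOver G (f c)) ∧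
  (∀ c k, ((f c).stk k).length ≤ (c.stk k).length + C) ∧
  ∀ {X : Type} (c : X → Cfg Γ Λ σ), (∀ x, CfgOver G (c x)) → ∀ P,
    Generates (observe (cfgObs Λ σ G (P + C)) c) (C * (P + 1))
      (observe (cfgObs Λ σ G P) fun x => f (c x))

namespace Simulable

variable {G : ∀ k, Finset (Γ k)} {f g : Cfg Γ Λ σ → Cfg Γ Λ σ} {C C' : ℕ}

theorem mono (h : C ≤ C') (hf : Simulable G f C) : Simulable G f C' :=
  ⟨hf.1, fun c k => (hf.2.1 c k).trans (by omega), fun c hc P =>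
    ((hf.2.2 c hc P).mono (Nat.mul_le_mul_right _ h)).weaken
      (observe_mono (cfgObs_mono G (by omega)) c)⟩

/-- Seeing `P` symbols after `g` requires `P + C'` symbols before it, hence `P + C' + C` before `f`.
The product `C * C'` covers the cost of `f` at the greater depth. -/
theorem comp (hg : Simulable G g C') (hf : Simulable G f C) :
    Simulable G (fun c => g (f c)) (C * (C' + 1) + C') := by
  refine ⟨fun c hc => hg.1 _ (hf.1 c hc), fun c k => ?_, fun c hc P => ?_⟩
  · have h1 := hg.2.1 (f c) k
    have h2 := hf.2.1 c k
    nlinarith [Nat.zero_le (C * C')]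
  · have h1 := hf.2.2 c hc (P + C')
    have h2 := hg.2.2 (fun x => f (c x)) (fun x => hf.1 _ (hc x)) P
    refine ((h1.trans h2).mono ?_).weaken (observe_mono (cfgObs_mono G ?_) c)
    · have : C * (C' * P) ≥ 0 := Nat.zero_le _
      nlinarith
    · nlinarith [Nat.zero_le (C * C')]

/-- For elementary operations: every single observation has a constant price `a`, and there are
linearly many in the depth. -/
theorem of_generates {a : ℕ} (h1 : ∀ c, CfgOver G c → CfgOver G (f c))
    (h2 : ∀ c k, ((f c).stk k).length ≤ (c.stk k).length + 1)
    (h3 : ∀ {X : Type} (c : X → Cfg Γ Λ σ), (∀ x, CfgOver G (c x)) → ∀ P, ∀ Q ∈ cfgObs Λ σ G P,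
      Generates (observe (cfgObs Λ σ G (P + 1)) c) a {fun x => Q (f (c x))}) :
    Simulable G f (cfgObsFactor Λ σ G * a + 1) := by
  refine ⟨h1, fun c k => (h2 c k).trans (by omega), fun c hc P => ?_⟩
  refine ((generates_observe (h3 c hc P)).mono ?_).weaken
    (observe_mono (cfgObs_mono G (by omega)) c)
  calc _ ≤ cfgObsFactor Λ σ G * (P + 1) * a := Nat.mul_le_mul_right _ (card_cfgObs_le G P)
    _ = cfgObsFactor Λ σ G * a * (P + 1) := by ring
    _ ≤ _ := Nat.mul_le_mul_right _ (by omega)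

/-- All alternatives are computed side by side, and the observable index selects among their
observations. -/
theorem mux {I : Type*} [DecidableEq I] [Fintype I] (ix : Cfg Γ Λ σ → I)
    (hix : ∀ P i, (fun c => decide (ix c = i)) ∈ cfgObs Λ σ G P)
    {f : I → Cfg Γ Λ σ → Cfg Γ Λ σ} (hf : ∀ i, Simulable G (f i) C) :
    Simulable G (fun c => f (ix c) c)
      (C + Fintype.card I * C + cfgObsFactor Λ σ G * (Fintype.card I * 2 + 1)) := by
  refine ⟨fun c hc => (hf _).1 c hc, fun c k => ((hf _).2.1 c k).trans (by omega),
    fun c hc P => ?_⟩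
  set A := observe (cfgObs Λ σ G (P + C)) c with hA
  have h1 := Generates.biUnion (A := A) univ (f := fun i => observe (cfgObs Λ σ G P)
    fun x => f i (c x)) fun i _ => (hf i).2.2 c hc P
  have h2 := (Generates.of_subset (subset_refl A)).union h1
  have h3 : Generates (A ∪ ⋃ i ∈ (univ : Finset I), observe (cfgObs Λ σ G P) fun x => f i (c x))
      ((cfgObs Λ σ G P).card * (Fintype.card I * 2 + 1))
      (observe (cfgObs Λ σ G P) fun x => f (ix (c x)) (c x)) := by
    refine generates_observe fun Q hQ => ?_
    refine Generates.lookup (c := 0) (fun x => ix (c x)) univ (by simp)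
      (fun i _ => Or.inl ⟨_, hix _ i, rfl⟩) (h := fun i x => Q (f i (c x)))
      fun i _ => Generates.of_mem (Or.inr ?_)
    simp only [Set.mem_iUnion]
    exact ⟨i, mem_univ _, Q, hQ, rfl⟩
  refine ((h2.trans h3).mono ?_).weaken (observe_mono (cfgObs_mono G (by omega)) c)
  have := Nat.mul_le_mul_right (Fintype.card I * 2 + 1) (card_cfgObs_le (Λ := Λ) (σ := σ) G P)
  rw [card_univ]
  nlinarith [Nat.zero_le (C * (P + 1))]

protected theorem id : Simulable G (fun c : Cfg Γ Λ σ => c) 0 :=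
  ⟨fun _ h => h, fun _ _ => le_rfl, fun _ _ _ => (Generates.of_subset subset_rfl).mono (by omega)⟩

theorem push [DecidableEq K] (k : K) (s : σ → Γ k) (hs : ∀ u, s u ∈ G k) : ∃ C, Simulable G
    (fun c : Cfg Γ Λ σ => ⟨c.l, c.var, Function.update c.stk k (s c.var :: c.stk k)⟩) C := by
  refine ⟨_, of_generates (a := Fintype.card σ * 3 + 1) ?_ ?_ ?_⟩
  · intro c hc k' g hg
    by_cases hk : k' = k
    · subst hk
      simp only [Function.update_self, List.mem_cons] at hg
      rcases hg with rfl | hg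
      exacts [hs _, hc _ _ hg]
    · simp only [Function.update_of_ne hk] at hg
      exact hc _ _ hg
  · intro c k'
    by_cases hk : k' = k
    · subst hk
      simp
    · simp [Function.update_of_ne hk]
  · intro X c hc P
    refine cfgObs_cases ?_ ?_ ?_
    · exact fun l => (Generates.of_mem (mem_observe (label_mem_cfgObs G _ l))).mono (Nat.zero_le _)
    · exact fun u => (Generates.of_mem (mem_observe (var_mem_cfgObs G _ u))).mono (Nat.zero_le _)
    · intro k' Q hQ
      by_cases hk : k' = k
      · subst hk
        obtain ⟨p, hp, o, ho, rfl⟩ := exists_of_mem_listObs hQ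
        simp only [Function.update_self]
        -- The top is now the pushed symbol, a function of the state; position `p + 1` holds what
        -- was at position `p`.
        cases p with
        | zero =>
          simp only [List.getElem?_cons_zero]
          exact Generates.table (fun x => (c x).var) univ (by simp)
            (fun u _ => mem_observe (var_mem_cfgObs G _ u)) fun u => decide (some (s u) = o)
        | succ p =>
          simp only [List.getElem?_cons_succ]
          exact (Generates.of_mem (mem_observe (stk_mem_cfgObs (mem_listObs (by omega) ho)))).mono
            (Nat.zero_le _)
      · simp only [Function.update_of_ne hk]
        exact (Generates.of_mem (mem_observe (stk_mem_cfgObs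
          (listObs_mono _ (Nat.le_succ _) hQ)))).mono (Nat.zero_le _)

omit [Fintype K] [∀ k, DecidableEq (Γ k)] [DecidableEq Λ] [Fintype Λ] [DecidableEq σ] [Fintype σ] in
theorem head_mem {c : Cfg Γ Λ σ} (hc : CfgOver G c) (k : K) :
    (c.stk k)[0]? ∈ Finset.insertNone (G k) := by
  rw [Finset.mem_insertNone]
  intro g hg
  exact hc k g (List.mem_of_getElem? hg)

/-- Functions of the state and the top of one stack can be computed by Boolean operations. -/
theorem generates_top {X : Type} {c : X → Cfg Γ Λ σ} (hc : ∀ x, CfgOver G (c x)) (k : K) (P : ℕ)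
    (h : σ → Option (Γ k) → Bool) : Generates (observe (cfgObs Λ σ G (P + 1)) c)
      (Fintype.card σ * (((G k).card + 1) * 3 + 1 + 2) + 1)
      {fun x => h (c x).var ((c x).stk k).head?} := by
  refine Generates.lookup (fun x => (c x).var) univ (by simp)
    (fun u _ => mem_observe (var_mem_cfgObs G _ u)) (h := fun u x => h u ((c x).stk k).head?)
    fun u _ => ?_
  simp only [List.head?_eq_getElem?]
  rw [← Finset.card_insertNone]
  exact Generates.table (fun x => ((c x).stk k)[0]?) (Finset.insertNone (G k))
    (fun x => head_mem (hc x) k)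
    (fun o ho => mem_observe (stk_mem_cfgObs (mem_listObs (Nat.succ_pos P) ho))) fun o => h u o

theorem peek (k : K) (s : σ → Option (Γ k) → σ) : ∃ C, Simulable G
    (fun c : Cfg Γ Λ σ => ⟨c.l, s c.var (c.stk k).head?, c.stk⟩) C := by
  refine ⟨_, of_generates (fun c hc => hc) (fun c k => Nat.le_succ _)
    (a := Fintype.card σ * (((G k).card + 1) * 3 + 1 + 2) + 1) ?_⟩
  intro X c hc P
  refine cfgObs_cases ?_ ?_ ?_
  · exact fun l => (Generates.of_mem (mem_observe (label_mem_cfgObs G _ l))).mono (Nat.zero_le _)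
  · exact fun u => generates_top hc k P fun v o => decide (s v o = u)
  · exact fun k' Q hQ => (Generates.of_mem (mem_observe (stk_mem_cfgObs
      (listObs_mono _ (Nat.le_succ _) hQ)))).mono (Nat.zero_le _)

theorem drop [DecidableEq K] (k : K) : ∃ C, Simulable G
    (fun c : Cfg Γ Λ σ => ⟨c.l, c.var, Function.update c.stk k (c.stk k).tail⟩) C := by
  refine ⟨_, of_generates (a := 0) ?_ ?_ ?_⟩
  · intro c hc k' g hg
    by_cases hk : k' = k
    · subst hk
      simp only [Function.update_self] at hg
      exact hc _ _ (List.mem_of_mem_tail hg)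
    · simp only [Function.update_of_ne hk] at hg
      exact hc _ _ hg
  · intro c k'
    by_cases hk : k' = k
    · subst hk
      simp
      omega
    · simp [Function.update_of_ne hk]
  · intro X c hc P
    refine cfgObs_cases ?_ ?_ ?_
    · exact fun l => Generates.of_mem (mem_observe (label_mem_cfgObs G _ l))
    · exact fun u => Generates.of_mem (mem_observe (var_mem_cfgObs G _ u))
    · intro k' Q hQ
      by_cases hk : k' = k
      · subst hk
        obtain ⟨p, hp, o, ho, rfl⟩ := exists_of_mem_listObs hQ
        simp only [Function.update_self, List.getElem?_tail]
        exact Generates.of_mem (mem_observe (stk_mem_cfgObs (mem_listObs (by omega) ho)))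
      · simp only [Function.update_of_ne hk]
        exact Generates.of_mem (mem_observe (stk_mem_cfgObs (listObs_mono _ (Nat.le_succ _) hQ)))

theorem load (s : σ → σ) : ∃ C, Simulable G
    (fun c : Cfg Γ Λ σ => ⟨c.l, s c.var, c.stk⟩) C := by
  refine ⟨_, of_generates (fun c hc => hc) (fun c k => Nat.le_succ _)
    (a := Fintype.card σ * 3 + 1) ?_⟩
  intro X c hc P
  refine cfgObs_cases ?_ ?_ ?_
  · exact fun l => (Generates.of_mem (mem_observe (label_mem_cfgObs G _ l))).mono (Nat.zero_le _)
  · exact fun u => Generates.table (fun x => (c x).var) univ (by simp)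
      (fun u _ => mem_observe (var_mem_cfgObs G _ u)) fun v => decide (s v = u)
  · exact fun k' Q hQ => (Generates.of_mem (mem_observe (stk_mem_cfgObs
      (listObs_mono _ (Nat.le_succ _) hQ)))).mono (Nat.zero_le _)

theorem jump (s : σ → Option Λ) : ∃ C, Simulable G
    (fun c : Cfg Γ Λ σ => ⟨s c.var, c.var, c.stk⟩) C := by
  refine ⟨_, of_generates (fun c hc => hc) (fun c k => Nat.le_succ _)
    (a := Fintype.card σ * 3 + 1) ?_⟩
  intro X c hc P
  refine cfgObs_cases ?_ ?_ ?_
  · exact fun l => Generates.table (fun x => (c x).var) univ (by simp)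
      (fun u _ => mem_observe (var_mem_cfgObs G _ u)) fun v => decide (s v = l)
  · exact fun u => (Generates.of_mem (mem_observe (var_mem_cfgObs G _ u))).mono (Nat.zero_le _)
  · exact fun k' Q hQ => (Generates.of_mem (mem_observe (stk_mem_cfgObs
      (listObs_mono _ (Nat.le_succ _) hQ)))).mono (Nat.zero_le _)

end Simulable

/-- The symbols that a statement can push. -/
def pushSymbols : Stmt Γ Λ σ → Set (Σ k, Γ k)
  | .push k s q => Set.range (fun u => ⟨k, s u⟩) ∪ pushSymbols q
  | .peek _ _ q => pushSymbols q
  | .pop _ _ q => pushSymbols q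
  | .load _ q => pushSymbols q
  | .branch _ q₁ q₂ => pushSymbols q₁ ∪ pushSymbols q₂
  | .goto _ => ∅
  | .halt => ∅

omit [Fintype K] [∀ k, DecidableEq (Γ k)] [DecidableEq Λ] [Fintype Λ]
  [DecidableEq σ] in
theorem finite_pushSymbols (q : Stmt Γ Λ σ) : (pushSymbols q).Finite := by
  induction q with
  | push k s q ih => exact (Set.finite_range _).union ih
  | peek _ _ q ih | pop _ _ q ih | load _ q ih => exact ih
  | branch _ q₁ q₂ h1 h2 => exact h1.union h2
  | goto | halt => exact Set.finite_empty

theorem simulable_stepAux [DecidableEq K] {G : ∀ k, Finset (Γ k)} (q : Stmt Γ Λ σ)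
    (hq : ∀ p ∈ pushSymbols q, p.2 ∈ G p.1) :
    ∃ C, Simulable G (fun c : Cfg Γ Λ σ => stepAux q c.var c.stk) C := by
  induction q with
  | push k s q ih =>
    obtain ⟨C, hC⟩ := ih fun p hp => hq p (Or.inr hp)
    obtain ⟨C', hC'⟩ := Simulable.push (Λ := Λ) (G := G) k s fun u => hq ⟨k, s u⟩ (Or.inl ⟨u, rfl⟩)
    exact ⟨_, hC.comp hC'⟩
  | peek k s q ih =>
    obtain ⟨C, hC⟩ := ih hq
    obtain ⟨C', hC'⟩ := Simulable.peek (Λ := Λ) (G := G) k s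
    exact ⟨_, hC.comp hC'⟩
  | pop k s q ih =>
    obtain ⟨C, hC⟩ := ih hq
    obtain ⟨C₁, hC₁⟩ := Simulable.peek (Λ := Λ) (G := G) k s
    obtain ⟨C₂, hC₂⟩ := Simulable.drop (Λ := Λ) (σ := σ) (G := G) k
    -- A pop is a peek, which updates the state from the top symbol, followed by the removal of that
    -- symbol.
    exact ⟨_, hC.comp (hC₂.comp hC₁)⟩
  | load s q ih =>
    obtain ⟨C, hC⟩ := ih hq
    obtain ⟨C', hC'⟩ := Simulable.load (Λ := Λ) (G := G) s
    exact ⟨_, hC.comp hC'⟩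
  | branch s q₁ q₂ h1 h2 =>
    obtain ⟨C₁, hC₁⟩ := h1 fun p hp => hq p (Or.inl hp)
    obtain ⟨C₂, hC₂⟩ := h2 fun p hp => hq p (Or.inr hp)
    refine ⟨_, Simulable.mux (C := C₁ + C₂) (fun c => c.var) (fun P u => var_mem_cfgObs G P u)
      (f := fun u c => cond (s u) (stepAux q₁ c.var c.stk) (stepAux q₂ c.var c.stk)) fun u => ?_⟩
    cases s u
    · exact hC₂.mono (by omega)
    · exact hC₁.mono (by omega)
  | goto s => exact Simulable.jump fun u => some (s u)
  | halt => exact Simulable.jump fun _ => none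

/-- The step function, continued by the identity on halting configurations. -/
def stepOrStay [DecidableEq K] (M : Λ → Stmt Γ Λ σ) (c : Cfg Γ Λ σ) : Cfg Γ Λ σ :=
  (step M c).getD c

theorem simulable_stepOrStay [DecidableEq K] {G : ∀ k, Finset (Γ k)} (M : Λ → Stmt Γ Λ σ)
    (hM : ∀ l, ∀ p ∈ pushSymbols (M l), p.2 ∈ G p.1) : ∃ C, Simulable G (stepOrStay M) C := by
  choose C hC using fun l => simulable_stepAux (M l) (hM l)
  have h : stepOrStay M = fun c => c.l.elim c fun l => stepAux (M l) c.var c.stk := by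
    ext1 ⟨l | l, v, S⟩ <;> rfl
  rw [h]
  -- The selection is by the label; the value `none` means that the machine has halted and selects
  -- the identity.
  refine ⟨_, (Simulable.mux (C := ∑ l, C l) (fun c : Cfg Γ Λ σ => c.l)
    (fun P l => label_mem_cfgObs G P l)
    (f := fun l c => l.elim c fun l => stepAux (M l) c.var c.stk) fun l => ?_)⟩
  cases l with
  | none => exact Simulable.id.mono (Nat.zero_le _)
  | some l => exact (hC l).mono (single_le_sum (fun _ _ => Nat.zero_le _) (mem_univ l))

/-- Going back one step deepens the observed part of the stacks by `C`. Charging every step the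
price at the greatest depth `P + t * C` gives the bound. -/
theorem Simulable.iterate_generates {G : ∀ k, Finset (Γ k)} {f : Cfg Γ Λ σ → Cfg Γ Λ σ} {C : ℕ}
    (hf : Simulable G f C) {X : Type} (c : X → Cfg Γ Λ σ) (hc : ∀ x, CfgOver G (c x)) (t P : ℕ) :
    Generates (observe (cfgObs Λ σ G (P + t * C)) c) (t * (C * (P + t * C + 1)))
      (observe (cfgObs Λ σ G P) fun x => f^[t] (c x)) := by
  induction t generalizing P with
  | zero => exact (Generates.of_subset (by simp)).mono (Nat.zero_le _)
  | succ t ih =>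
    have hc' : ∀ t, ∀ x, CfgOver G (f^[t] (c x)) := by
      intro t x
      induction t with
      | zero => exact hc x
      | succ t ih =>
        rw [Function.iterate_succ_apply']
        exact hf.1 _ ih
    have h := (ih (P + C)).trans (hf.2.2 _ (hc' t) P)
    simp only [Function.iterate_succ_apply']
    have e : P + C + t * C = P + (t + 1) * C := by ring
    rw [e] at h
    refine h.mono ?_
    have h2 : C * (P + 1) ≤ C * (P + (t + 1) * C + 1) := Nat.mul_le_mul_left _ (by omega)
    rw [add_mul t _ (C * _), one_mul]
    omega

theorem Simulable.length_iterate_le {G : ∀ k, Finset (Γ k)} {f : Cfg Γ Λ σ → Cfg Γ Λ σ} {C : ℕ}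
    (hf : Simulable G f C) (c : Cfg Γ Λ σ) (t : ℕ) (k : K) :
    ((f^[t] c).stk k).length ≤ (c.stk k).length + t * C := by
  induction t with
  | zero => simp
  | succ t ih =>
    rw [Function.iterate_succ_apply']
    have := hf.2.1 (f^[t] c) k
    rw [add_mul]
    omega

end Simulation

/-! ### Boolean computation of the output of a machine -/

section Output

open Turing Finset

section Machine

/-- A run that ends in an actual configuration never meets `none`, so the total step function
follows it. -/
theorem iterate_stepOrStay {K : Type*} [DecidableEq K] {Γ : K → Type*} {Λ σ : Type*}
    (M : Λ → TM2.Stmt Γ Λ σ) {c c' : TM2.Cfg Γ Λ σ} {s : ℕ}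
    (h : (flip bind (TM2.step M))^[s] (some c) = some c') : (stepOrStay M)^[s] c = c' := by
  induction s generalizing c with
  | zero => simpa using h
  | succ s ih =>
    rw [Function.iterate_succ_apply] at h ⊢
    have hb : flip bind (TM2.step M) (some c) = TM2.step M c := rfl
    rw [hb] at h
    cases hc : TM2.step M c with
    | none =>
      rw [hc] at h
      have hnone : ∀ s, (flip bind (TM2.step M))^[s] none = none := by
        intro s
        induction s with
        | zero => rfl
        | succ s ih => rw [Function.iterate_succ_apply]; exact ih
      rw [hnone] at h
      cases h
    | some c₁ =>
      rw [hc] at h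
      have : stepOrStay M c = c₁ := by simp [stepOrStay, hc]
      rw [this]
      exact ih h

theorem iterate_stepOrStay_of_halted {K : Type*} [DecidableEq K] {Γ : K → Type*} {Λ σ : Type*}
    (M : Λ → TM2.Stmt Γ Λ σ) {c : TM2.Cfg Γ Λ σ} (hc : c.l = none) (s : ℕ) :
    (stepOrStay M)^[s] c = c := by
  refine Function.iterate_fixed ?_ s
  obtain ⟨l, v, S⟩ := c
  subst hc
  rfl

/-- Idling after the halt makes all inputs run for the same number `t` of steps, so that one
straight-line program serves them all. -/
theorem iterate_stepOrStay_of_outputs {tm : FinTM2} {a : List (tm.Γ tm.k₀)}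
    {b : List (tm.Γ tm.k₁)} {t : ℕ} (h : TM2OutputsInTime tm a (some b) t) :
    (stepOrStay tm.m)^[t] (initList tm a) = haltList tm b := by
  obtain ⟨⟨s, e⟩, hs⟩ := h
  have h1 : (stepOrStay tm.m)^[s] (initList tm a) = haltList tm b := iterate_stepOrStay tm.m e
  obtain ⟨r, rfl⟩ : ∃ r, t = r + s := ⟨t - s, (Nat.sub_add_cancel hs).symm⟩
  exact (Function.iterate_add_apply _ r s _).trans
    ((congrArg _ h1).trans (iterate_stepOrStay_of_halted tm.m (c := haltList tm b) rfl r))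

theorem initList_stk_self (tm : FinTM2) (a : List (tm.Γ tm.k₀)) :
    (initList tm a).stk tm.k₀ = a := by
  simp [initList]

theorem initList_stk_of_ne (tm : FinTM2) (a : List (tm.Γ tm.k₀)) {k : tm.K} (hk : k ≠ tm.k₀) :
    (initList tm a).stk k = [] := by
  simp [initList, hk]

theorem haltList_stk_self (tm : FinTM2) (a : List (tm.Γ tm.k₁)) :
    (haltList tm a).stk tm.k₁ = a := by
  simp [haltList]

end Machine

/-- The binary code of a number, terminated by `none`. -/
def natWord (a : ℕ) : List (Option Bool) :=
  (Nat.bits a).map some ++ [none]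

theorem length_natWord_le {a n : ℕ} (h : a ≤ n) : (natWord a).length ≤ n + 1 := by
  have : (Nat.bits a).length ≤ n := by
    rw [Nat.size_eq_bits_len, Nat.size_le]
    exact h.trans_lt Nat.lt_two_pow_self
  simpa [natWord] using this

theorem length_flatMap_natWord_le {n : ℕ} (l : List ℕ) (hl : ∀ a ∈ l, a ≤ n) :
    (l.flatMap natWord).length ≤ l.length * (n + 1) := by
  induction l with
  | nil => simp
  | cons a l ih =>
    have h1 := ih fun b hb => hl b (List.mem_cons_of_mem _ hb)
    have h2 := length_natWord_le (hl a List.mem_cons_self)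
    simp only [List.flatMap_cons, List.length_append, List.length_cons, add_mul, one_mul]
    omega

theorem length_encodeEntry_le {n d : ℕ} (i j : Fin d → Fin n) :
    (encodeEntry n i j).length ≤ (2 * d + 1) * (n + 1) := by
  refine (length_flatMap_natWord_le (n := n) _ ?_).trans (le_of_eq ?_)
  · intro a ha
    simp only [List.cons_append, List.mem_cons, List.mem_append, List.mem_ofFn'] at ha
    rcases ha with rfl | ⟨k, rfl⟩ | ⟨k, rfl⟩
    · exact le_rfl
    · exact (i k).isLt.le
    · exact (j k).isLt.le
  · simp
    ring

/-- The Boolean inputs `x k = a`. -/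
def inputTests (D : Type) (n : ℕ) : Set ((D → Fin n) → Bool) :=
  {f | ∃ k a, f = fun x => decide (x k = a)}

theorem generates_encodeEntry (n d P : ℕ) :
    Generates (inputTests (Fin d ⊕ Fin d) n)
      (1 + ((2 * d + 1) * (P * 4 * (n * 3 + 1)) + P * 4 * 4))
      (observe (listObs (univ : Finset (Option Bool)) P)
        fun x => encodeEntry n (fun k => x (.inl k)) fun k => x (.inr k)) := by
  set A := inputTests (Fin d ⊕ Fin d) n
  -- The constant `true` is the indicator of the only index in `Fin 1`; with it the fixed code of
  -- `n` is prepended by the same lemma as for variable words.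
  have h1 : Generates A 1 (A ∪ {fun _ => true}) :=
    ((Generates.of_subset subset_rfl).union (Generates.const A true)).mono (by omega)
  refine h1.trans ?_
  let l : List ((Fin d ⊕ Fin d → Fin n) → Fin n) :=
    (List.ofFn fun k x => x (.inl k)) ++ List.ofFn fun k x => x (.inr k)
  have h2 := generates_listObs_flatMap (A := A ∪ {fun _ => true}) (univ : Finset (Option Bool)) P
    (fun a : Fin n => natWord a) l ?_
  · have h3 := h2.listObs_append (n := 1) (fun _ => natWord n) (fun _ => 0) ?_
    · convert h3 using 2
      · have hl : l.length = 2 * d := by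
          simp [l]
          ring
        have hcard : (univ : Finset (Option Bool)).card + 1 = 4 := rfl
        rw [hl, hcard]
      · rfl
      · funext x
        simp [l, encodeEntry, encodeNats, natWord, List.flatMap_def,
          List.map_ofFn, Function.comp_def]
    · intro i
      right
      simp [Subsingleton.elim 0 i]
  · intro a ha i
    left
    simp only [l, List.mem_append, List.mem_ofFn'] at ha
    rcases ha with ⟨k, rfl⟩ | ⟨k, rfl⟩
    exacts [⟨.inl k, i, rfl⟩, ⟨.inr k, i, rfl⟩]

/-- The stack alphabets may be infinite, but finitely many statements and states push only finitely
many symbols. Together with the input and output alphabets these are all that matter. -/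
theorem exists_alphabet (tm : FinTM2) [Finite (tm.Γ tm.k₁)] :
    ∃ G : ∀ k, Finset (tm.Γ k), (∀ l, ∀ p ∈ pushSymbols (tm.m l), p.2 ∈ G p.1) ∧
      (∀ g, g ∈ G tm.k₀) ∧ ∀ g, g ∈ G tm.k₁ := by
  have := tm.ΛFin
  have := tm.σFin
  have := tm.Γk₀Fin
  let S : Set (Σ k, tm.Γ k) := (⋃ l, pushSymbols (tm.m l)) ∪
    (Set.range (Sigma.mk tm.k₀) ∪ Set.range (Sigma.mk tm.k₁))
  have hS : S.Finite := (Set.finite_iUnion fun l => finite_pushSymbols _).union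
    ((Set.finite_range _).union (Set.finite_range _))
  have hG : ∀ k, (Sigma.mk k ⁻¹' S).Finite := fun k =>
    hS.preimage (sigma_mk_injective.injOn)
  refine ⟨fun k => (hG k).toFinset, fun l p hp => ?_, fun g => ?_, fun g => ?_⟩
  · simp only [Set.Finite.mem_toFinset]
    exact Or.inl (Set.mem_iUnion.2 ⟨l, hp⟩)
  · simp [S]
  · simp [S]

/-- The output of a machine with running time `t` on the matrix entries can be computed by Boolean
operations whose number is polynomial in `n`, `d` and `t`. -/
theorem exists_generates_output {m : ℕ} (T : TM2ComputableAux (Option Bool) (Option (Fin m))) :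
    ∃ C, ∀ (n d t : ℕ) (w : (Fin d ⊕ Fin d → Fin n) → List (Option (Fin m))),
      (∀ x, Nonempty (TM2OutputsInTime T.tm
        ((encodeEntry n (fun k => x (.inl k)) fun k => x (.inr k)).map T.inputAlphabet.symm)
        (some ((w x).map T.outputAlphabet.symm)) t)) →
      (∀ x, (w x).length ≤ (2 * d + 1) * (n + 1) + t * C) ∧
      ∀ P, Generates (inputTests (Fin d ⊕ Fin d) n)
        (1 + ((2 * d + 1) * ((P + t * C) * 4 * (n * 3 + 1)) + (P + t * C) * 4 * 4) +
          C * (P + t * C + 1) + t * (C * (P + t * C + 1)))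
        (observe (listObs univ P) w) := by
  classical
  have := T.tm.ΛFin
  have := T.tm.σFin
  have := T.tm.kFin
  have : Finite (T.tm.Γ T.tm.k₁) := Finite.of_equiv _ T.outputAlphabet.symm
  obtain ⟨G, hG, hG₀, hG₁⟩ := exists_alphabet T.tm
  obtain ⟨C, hC⟩ := simulable_stepOrStay T.tm.m hG
  -- `C` is enlarged so that it also bounds the number of observations of the starting
  -- configuration.
  have hC := hC.mono (Nat.le_add_right C (cfgObsFactor T.tm.Λ T.tm.σ G))
  have hB : cfgObsFactor T.tm.Λ T.tm.σ G ≤ C + cfgObsFactor T.tm.Λ T.tm.σ G :=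
    Nat.le_add_left _ _
  generalize C + cfgObsFactor T.tm.Λ T.tm.σ G = C at hC hB
  refine ⟨C, fun n d t w hw => ?_⟩
  let enc : (Fin d ⊕ Fin d → Fin n) → List (Option Bool) := fun x =>
    encodeEntry n (fun k => x (.inl k)) fun k => x (.inr k)
  let init : (Fin d ⊕ Fin d → Fin n) → TM2.Cfg T.tm.Γ T.tm.Λ T.tm.σ := fun x =>
    initList T.tm ((enc x).map T.inputAlphabet.symm)
  have hinit : ∀ x, CfgOver G (init x) := by
    intro x k g hg
    by_cases hk : k = T.tm.k₀
    · subst hk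
      exact hG₀ g
    · simp [init, initList_stk_of_ne _ _ hk] at hg
  have hrun : ∀ x, (stepOrStay T.tm.m)^[t] (init x) =
      haltList T.tm ((w x).map T.outputAlphabet.symm) := fun x =>
    iterate_stepOrStay_of_outputs (hw x).some
  refine ⟨fun x => ?_, fun P => ?_⟩
  · have h1 := hC.length_iterate_le (init x) t T.tm.k₁
    rw [hrun, haltList_stk_self, List.length_map] at h1
    refine h1.trans (Nat.add_le_add_right ?_ _)
    refine le_trans ?_ (length_encodeEntry_le (fun k => x (.inl k)) fun k => x (.inr k))
    -- The output stack starts with the input if it is also the input stack, and empty otherwise.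
    by_cases hk : T.tm.k₁ = T.tm.k₀
    · have key : ∀ k, k = T.tm.k₀ → ((init x).stk k).length = (enc x).length := by
        rintro k rfl
        simp only [init, initList_stk_self, List.length_map]
      exact (key _ hk).le
    · simp [init, initList_stk_of_ne _ _ hk]
  · have h1 := generates_encodeEntry n d (P + t * C)
    set A := inputTests (Fin d ⊕ Fin d) n
    have h2 : Generates (observe (listObs (univ : Finset (Option Bool)) (P + t * C)) enc)
        (C * (P + t * C + 1)) (observe (cfgObs T.tm.Λ T.tm.σ G (P + t * C)) init) := by
      refine (generates_observe (c := 1) ?_).mono (b := C * (P + t * C + 1)) ?_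
      · refine cfgObs_cases ?_ ?_ ?_
        · exact fun l => Generates.const _ (decide (some T.tm.main = l))
        · exact fun u => Generates.const _ (decide (T.tm.initialState = u))
        · intro k Q hQ
          by_cases hk : k = T.tm.k₀
          · subst hk
            obtain ⟨p, hp, o, ho, rfl⟩ := exists_of_mem_listObs hQ
            refine (Generates.of_mem ?_).mono (Nat.zero_le _)
            convert mem_observe (v := enc) (mem_listObs hp
              (Finset.mem_insertNone.2 fun a _ => mem_univ a : o.map T.inputAlphabet ∈ _)) using 2 with x
            rw [decide_eq_decide]
            simp only [init, initList_stk_self, List.getElem?_map]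
            cases (enc x)[p]? <;> cases o <;> simp [Equiv.symm_apply_eq]
          · simp only [init, initList_stk_of_ne _ _ hk]
            exact Generates.const _ _
      · rw [mul_one]
        exact (card_cfgObs_le G _).trans (Nat.mul_le_mul_right _ hB)
    have h3 := hC.iterate_generates init hinit t P
    refine (((h1.trans h2).trans h3)).anti ?_
    rintro f ⟨Q, hQ, rfl⟩
    obtain ⟨p, hp, o, ho, rfl⟩ := exists_of_mem_listObs hQ
    have hmem : (fun L : List (T.tm.Γ T.tm.k₁) => decide (L[p]? = o.map T.outputAlphabet.symm)) ∈
        listObs (G T.tm.k₁) P :=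
      mem_listObs hp (Finset.mem_insertNone.2 fun a _ => hG₁ a)
    convert mem_observe (stk_mem_cfgObs (Λ := T.tm.Λ) (σ := T.tm.σ) hmem) using 2 with x
    rw [decide_eq_decide, hrun, haltList_stk_self, List.getElem?_map]
    cases (w x)[p]? <;> cases o <;> simp

end Output

/-! ### Formula size of compound polynomials -/

section FormulaSize

variable {F : Type*} [Field F] {V V' : Type*}

theorem formulaSize_C_le (c : F) : formulaSize (MvPolynomial.C c : MvPolynomial V F) ≤ 1 :=
  formulaSize_le (.const c)

theorem formulaSize_zero_le : formulaSize (0 : MvPolynomial V F) ≤ 1 := by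
  simpa using formulaSize_C_le (V := V) (0 : F)

theorem formulaSize_one_le : formulaSize (1 : MvPolynomial V F) ≤ 1 := by
  simpa using formulaSize_C_le (V := V) (1 : F)

theorem formulaSize_X_le (x : V) : formulaSize (MvPolynomial.X x : MvPolynomial V F) ≤ 1 :=
  formulaSize_le (.var x)

theorem formulaSize_add_le (p q : MvPolynomial V F) :
    formulaSize (p + q) ≤ formulaSize p + formulaSize q := by
  obtain ⟨φ, rfl, hφ⟩ := exists_formula_size_eq p
  obtain ⟨ψ, rfl, hψ⟩ := exists_formula_size_eq q
  rw [← hφ, ← hψ]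
  exact formulaSize_le (.add φ ψ)

theorem formulaSize_mul_le (p q : MvPolynomial V F) :
    formulaSize (p * q) ≤ formulaSize p + formulaSize q := by
  obtain ⟨φ, rfl, hφ⟩ := exists_formula_size_eq p
  obtain ⟨ψ, rfl, hψ⟩ := exists_formula_size_eq q
  rw [← hφ, ← hψ]
  exact formulaSize_le (.mul φ ψ)

/-- The additional leaf is the constant `0` of the empty sum. -/
theorem formulaSize_sum_le {ι : Type*} (s : Finset ι) (p : ι → MvPolynomial V F) {b : ℕ}
    (h : ∀ i ∈ s, formulaSize (p i) ≤ b) : formulaSize (∑ i ∈ s, p i) ≤ s.card * b + 1 := by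
  classical
  induction s using Finset.induction_on with
  | empty => simpa using formulaSize_zero_le
  | insert i s hi ih =>
    rw [Finset.sum_insert hi, Finset.card_insert_of_notMem hi, add_mul]
    have h1 := ih fun j hj => h j (Finset.mem_insert_of_mem hj)
    have h2 := h i (Finset.mem_insert_self _ _)
    have h3 := formulaSize_add_le (p i) (∑ i ∈ s, p i)
    omega

theorem formulaSize_prod_le {ι : Type*} (s : Finset ι) (p : ι → MvPolynomial V F) {b : ℕ}
    (h : ∀ i ∈ s, formulaSize (p i) ≤ b) : formulaSize (∏ i ∈ s, p i) ≤ s.card * b + 1 := by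
  classical
  induction s using Finset.induction_on with
  | empty => simpa using formulaSize_one_le
  | insert i s hi ih =>
    rw [Finset.prod_insert hi, Finset.card_insert_of_notMem hi, add_mul]
    have h1 := ih fun j hj => h j (Finset.mem_insert_of_mem hj)
    have h2 := h i (Finset.mem_insert_self _ _)
    have h3 := formulaSize_mul_le (p i) (∏ i ∈ s, p i)
    omega

/-- Renaming the variables of a formula. -/
def ArithFormula.map (f : V → V') : ArithFormula F V → ArithFormula F V'
  | const c => const c
  | var x => var (f x)
  | add φ ψ => add (φ.map f) (ψ.map f)
  | mul φ ψ => mul (φ.map f) (ψ.map f)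

theorem ArithFormula.eval_map (f : V → V') (φ : ArithFormula F V) :
    (φ.map f).eval = MvPolynomial.rename f φ.eval := by
  induction φ with
  | const c | var x => simp [map, eval]
  | add φ ψ h1 h2 | mul φ ψ h1 h2 => simp [map, eval, h1, h2]

omit [Field F] in
theorem ArithFormula.size_map (f : V → V') (φ : ArithFormula F V) : (φ.map f).size = φ.size := by
  induction φ with
  | const c | var x => rfl
  | add φ ψ h1 h2 | mul φ ψ h1 h2 => simp [map, size, h1, h2]

theorem formulaSize_rename_le (f : V → V') (p : MvPolynomial V F) :
    formulaSize (MvPolynomial.rename f p) ≤ formulaSize p := by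
  obtain ⟨φ, rfl, hφ⟩ := exists_formula_size_eq p
  rw [← hφ, ← φ.eval_map, ← φ.size_map f]
  exact formulaSize_le _

end FormulaSize

/-! ### Arithmetization -/

section Arithmetization

open MvPolynomial

variable {F : Type*} [Field F] {V : Type*}

/-- A Boolean assignment as a point of affine space. -/
def boolPoint (F : Type*) [Field F] (e : V → Bool) (v : V) : F := if e v then 1 else 0

/-- The literal `v = b`. -/
noncomputable def literal (F : Type*) [Field F] (b : Bool) (v : V) : MvPolynomial V F :=
  if b then X v else C 1 + C (-1) * X v

theorem eval_literal (e : V → Bool) (b : Bool) (v : V) :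
    eval (boolPoint F e) (literal F b v) = if e v = b then 1 else 0 := by
  cases b <;> cases h : e v <;> simp [literal, boolPoint, h]

theorem formulaSize_literal_le (b : Bool) (v : V) : formulaSize (literal F b v) ≤ 3 := by
  unfold literal
  split_ifs
  · exact (formulaSize_X_le v).trans (by norm_num)
  · refine (formulaSize_add_le _ _).trans (Nat.add_le_add (formulaSize_C_le _)
      ((formulaSize_mul_le _ _).trans (Nat.add_le_add (formulaSize_C_le _) (formulaSize_X_le _))))

/-- The polynomial that checks that the values of a straight-line program are correct. -/
theorem exists_check_polynomial {X : Type*} {V : Type} (ι : X → V → Bool) {A : Set (X → Bool)}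
    (hA : ∀ f ∈ A, ∃ v, f = fun x => ι x v) : ∀ {L : List (X → Bool)}, IsStraightLine A L →
    ∃ (W : Type) (_ : Fintype W) (_ : DecidableEq W) (val : X → W → Bool)
      (χ : MvPolynomial (V ⊕ W) F), Fintype.card W ≤ L.length ∧
      formulaSize χ ≤ 37 * L.length + 1 ∧
      (∀ x w, eval (boolPoint F (Sum.elim (ι x) w)) χ = if w = val x then 1 else 0) ∧
      ∀ f, f ∈ A ∨ f ∈ L → ∃ v, ∀ x, Sum.elim (ι x) (val x) v = f x
  | [], _ => by
    refine ⟨Empty, inferInstance, inferInstance, fun _ => Empty.elim, 1, by simp,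
      by simpa using formulaSize_one_le, fun x w => ?_, ?_⟩
    · rw [if_pos (Subsingleton.elim _ _), map_one]
    · rintro f (hf | hf)
      · obtain ⟨v, rfl⟩ := hA f hf
        exact ⟨.inl v, fun x => rfl⟩
      · simp at hf
  | f :: L, hL => by
    obtain ⟨W, _, _, val, χ, hW, hχs, hχ, hv⟩ := exists_check_polynomial ι hA hL.1
    -- `τ` tests the new variable alone. It has to be right only if the earlier variables are,
    -- because otherwise `χ` already vanishes.
    have key : ∃ τ : MvPolynomial (V ⊕ Option W) F, formulaSize τ ≤ 37 ∧
        ∀ x (w : Option W → Bool), (fun o => w (some o)) = val x →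
          eval (boolPoint F (Sum.elim (ι x) w)) τ = if w none = f x then 1 else 0 := by
      rcases hL.2 with ⟨b, rfl⟩ | ⟨op, g, h, hg, hh, rfl⟩
      · exact ⟨literal F b (.inr none), (formulaSize_literal_le _ _).trans (by norm_num),
          fun x w _ => eval_literal _ _ _⟩
      · obtain ⟨u, hu⟩ := hv g hg
        obtain ⟨v, hv⟩ := hv h hh
        let r : V ⊕ W → V ⊕ Option W := Sum.map id some
        -- One term for each pair of operand values, with three literals of size at most 3 each;
        -- this gives `4 * 9 + 1 = 37`.
        refine ⟨∑ q : Bool × Bool, literal F q.1 (r u) * literal F q.2 (r v) *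
          literal F (op q.1 q.2) (.inr none), ?_, fun x w hw => ?_⟩
        · refine (formulaSize_sum_le _ _ (b := 9) fun q _ => ?_).trans (by simp)
          exact (formulaSize_mul_le _ _).trans (Nat.add_le_add ((formulaSize_mul_le _ _).trans
            (Nat.add_le_add (formulaSize_literal_le _ _) (formulaSize_literal_le _ _)))
            (formulaSize_literal_le _ _))
        · have hr : ∀ y, Sum.elim (ι x) w (r y) = Sum.elim (ι x) (val x) y := by
            rintro (y | y)
            · rfl
            · simp [r, ← hw]
          simp only [map_sum, map_mul, eval_literal, hr, hu, hv]
          rw [Finset.sum_eq_single (g x, h x)]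
          · rw [if_pos rfl, if_pos rfl, one_mul, one_mul]
            rfl
          · rintro ⟨a, b⟩ - hab
            by_cases h1 : g x = a
            · by_cases h2 : h x = b
              · exact absurd (Prod.ext h1.symm h2.symm) hab
              · simp [h2]
            · simp [h1]
          · simp
    obtain ⟨τ, hτs, hτ⟩ := key
    let r : V ⊕ W → V ⊕ Option W := Sum.map id some
    refine ⟨Option W, inferInstance, inferInstance, fun x o => o.elim (f x) (val x),
      rename r χ * τ, by simpa using hW, ?_, fun x w => ?_, ?_⟩
    · have h1 := formulaSize_mul_le (rename r χ) τ
      have h2 := formulaSize_rename_le r χ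
      simp only [List.length_cons]
      omega
    · have hr : boolPoint F (Sum.elim (ι x) w) ∘ r =
          boolPoint F (Sum.elim (ι x) fun o => w (some o)) := by
        funext y
        rcases y with y | y <;> rfl
      rw [map_mul, eval_rename, hr, hχ]
      by_cases hw : (fun o => w (some o)) = val x
      · rw [if_pos hw, one_mul, hτ x w hw]
        refine if_congr ⟨fun h => ?_, fun h => by rw [h]; rfl⟩ rfl rfl
        funext o
        cases o with
        | none => exact h
        | some o => exact congrFun hw o
      · rw [if_neg hw, zero_mul, if_neg]
        rintro rfl
        exact hw rfl
    · intro g hg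
      rw [List.mem_cons] at hg
      by_cases hgf : g = f
      · exact ⟨.inr none, fun x => by rw [hgf]; rfl⟩
      · obtain ⟨v, hv⟩ := hv g (by tauto)
        refine ⟨r v, fun x => ?_⟩
        rw [← hv x]
        rcases v with v | v <;> rfl

/-! ### Evaluation of words -/

/-- One step of the evaluation of a word. -/
def wordStep {m : ℕ} (c : Fin m → F) (st : F × F) : Option (Fin m) → F × F
  | some k => (st.1, st.2 * c k)
  | none => (st.1 + st.2, 1)

theorem wordValue_eq {m : ℕ} (c : Fin m → F) (w : List (Option (Fin m))) :
    wordValue c w = (w.foldl (wordStep c) (0, 1)).1 := by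
  unfold wordValue
  congr 2

/-- `S` is the sum of the finished monomials and `R` the current one. At each position `R` is
multiplied by the constant read, reset to 1 at a separator, or kept when the word is over (`t P
none`). `R` enters its own update once, so its size is linear in `P` and that of `S` quadratic. -/
theorem exists_word_polynomial {m : ℕ} (c : Fin m → F)
    {t : ℕ → Option (Option (Fin m)) → MvPolynomial V F} (ht : ∀ p o, formulaSize (t p o) ≤ 1)
    (P : ℕ) : ∃ S R : MvPolynomial V F, formulaSize R ≤ P * (2 * m + 3) + 1 ∧
      formulaSize S ≤ P * (P * (2 * m + 3) + 2) + 1 ∧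
      ∀ (e : V → F) (w : List (Option (Fin m))),
        (∀ p < P, ∀ o, eval e (t p o) = if w[p]? = o then 1 else 0) →
        (eval e S, eval e R) = (w.take P).foldl (wordStep c) (0, 1) := by
  induction P with
  | zero => exact ⟨0, 1, by simpa using formulaSize_one_le, by simpa using formulaSize_zero_le,
      fun e w _ => by simp⟩
  | succ P ih =>
    obtain ⟨S, R, hR, hS, h⟩ := ih
    refine ⟨S + t P (some none) * R,
      R * (∑ k, t P (some (some k)) * C (c k) + t P none) + t P (some none), ?_, ?_, ?_⟩
    · have h1 := formulaSize_add_le (R * (∑ k, t P (some (some k)) * C (c k) + t P none))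
        (t P (some none))
      have h2 := formulaSize_mul_le R (∑ k, t P (some (some k)) * C (c k) + t P none)
      have h3 := formulaSize_add_le (∑ k, t P (some (some k)) * C (c k)) (t P none)
      have h4 := formulaSize_sum_le Finset.univ (fun k => t P (some (some k)) * C (c k)) (b := 2)
        fun k _ => (formulaSize_mul_le _ _).trans
          (Nat.add_le_add (ht _ _) (formulaSize_C_le _))
      rw [Finset.card_univ, Fintype.card_fin] at h4
      have h5 := ht P none
      have h6 := ht P (some none)
      rw [add_mul]
      omega
    · have h1 := formulaSize_add_le S (t P (some none) * R)
      have h2 := formulaSize_mul_le (t P (some none)) R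
      have h3 := ht P (some none)
      have h4 : P * (P * (2 * m + 3) + 2) + (P * (2 * m + 3) + 2) ≤
          (P + 1) * ((P + 1) * (2 * m + 3) + 2) := by nlinarith
      omega
    · intro e w hw
      have h1 := h e w fun p hp => hw p (by omega)
      rw [List.take_add_one, List.foldl_append, ← h1]
      have h2 := hw P (Nat.lt_succ_self P)
      simp only [map_add, map_mul, map_sum, h2, eval_C]
      rcases w[P]? with _ | _ | k
      · simp
      · simp [wordStep]
      · simp [wordStep]

/-! ### Boolean sums -/

/-- Substitution of Boolean values for the variables in `E`. -/
noncomputable def boolSubst {S E : Type*} (F : Type*) [Field F] (e : E → Bool) :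
    MvPolynomial (S ⊕ E) F →ₐ[F] MvPolynomial S F :=
  aeval (Sum.elim X fun v => if e v then 1 else 0)

theorem boolSubst_rename_inr {S E : Type*} (e : E → Bool) (p : MvPolynomial E F) :
    boolSubst F e (rename Sum.inr p : MvPolynomial (S ⊕ E) F) = C (eval (boolPoint F e) p) := by
  rw [boolSubst, aeval_rename, Sum.elim_comp_inr]
  have : (fun v => if e v then 1 else 0 : E → MvPolynomial S F) =
      algebraMap F (MvPolynomial S F) ∘ boolPoint F e := by
    funext v
    simp only [boolPoint, Function.comp_apply]
    split_ifs <;> simp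
  rw [this, aeval_algebraMap_apply, ← algebraMap_eq]
  rfl

theorem boolSubst_rename_map {S E E' : Type*} (r : E → E') (e : E' → Bool)
    (p : MvPolynomial (S ⊕ E) F) :
    boolSubst F e (rename (Sum.map id r) p) = boolSubst F (fun v => e (r v)) p := by
  rw [boolSubst, boolSubst, aeval_rename]
  congr 2
  funext v
  rcases v with v | v <;> rfl

/-! ### One-hot encodings of index vectors, and the polynomial as a Boolean sum. -/

variable {n d : ℕ} {D : Type} [Fintype D] [DecidableEq D]

/-- The one-hot encoding of `x`. -/
def oneHot (x : D → Fin n) (v : D × Fin n) : Bool := decide (x v.1 = v.2)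

/-- The polynomial that checks that an assignment is a one-hot encoding. -/
noncomputable def oneHotPoly (F : Type*) [Field F] (D : Type) [Fintype D] (n : ℕ) :
    MvPolynomial (D × Fin n) F :=
  ∏ k : D, ∑ a : Fin n, ∏ b : Fin n, literal F (decide (a = b)) (k, b)

omit [DecidableEq D] in
theorem formulaSize_oneHotPoly_le :
    formulaSize (oneHotPoly F D n) ≤ Fintype.card D * (n * (n * 3 + 1) + 1) + 1 := by
  have h1 : ∀ (k : D) (a : Fin n),
      formulaSize (∏ b : Fin n, literal F (decide (a = b)) (k, b)) ≤ n * 3 + 1 := fun k a => by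
    simpa using formulaSize_prod_le Finset.univ (fun b : Fin n => literal F (decide (a = b)) (k, b))
      fun b _ => formulaSize_literal_le _ _
  have h2 : ∀ k : D,
      formulaSize (∑ a : Fin n, ∏ b : Fin n, literal F (decide (a = b)) (k, b)) ≤
        n * (n * 3 + 1) + 1 := fun k => by
    simpa using formulaSize_sum_le Finset.univ _ fun a _ => h1 k a
  exact formulaSize_prod_le Finset.univ _ fun k _ => h2 k

/-- Expanding the product of sums yields one term per function `x`, and the product of literals in
that term is the indicator of its encoding. -/
theorem eval_oneHotPoly (e : D × Fin n → Bool) :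
    eval (boolPoint F e) (oneHotPoly F D n) = ∑ x : D → Fin n, if e = oneHot x then 1 else 0 := by
  simp only [oneHotPoly, map_prod, map_sum, eval_literal]
  rw [Finset.prod_univ_sum]
  simp only [Fintype.piFinset_univ]
  refine Finset.sum_congr rfl fun x _ => ?_
  by_cases h : e = oneHot x
  · rw [if_pos h, h]
    exact Finset.prod_eq_one fun k _ => Finset.prod_eq_one fun b _ => if_pos rfl
  · rw [if_neg h]
    obtain ⟨⟨k, b⟩, hkb⟩ := Function.ne_iff.1 h
    exact Finset.prod_eq_zero (Finset.mem_univ k)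
      (Finset.prod_eq_zero (Finset.mem_univ b) (if_neg hkb))

/-- The left index of the `k`-th variable, as a function of the one-hot encoding. -/
noncomputable def leftSelector (F : Type*) [Field F] (n d : ℕ) (k : Fin (d + 1))
    (a : Option (Fin n)) : MvPolynomial ((Fin d ⊕ Fin d) × Fin n) F :=
  Fin.cases (motive := fun _ => MvPolynomial ((Fin d ⊕ Fin d) × Fin n) F)
    (if a = none then 1 else 0) (fun l => a.elim 0 fun a => X (.inr l, a)) k

/-- The right index of the `k`-th variable, as a function of the one-hot encoding. -/
noncomputable def rightSelector (F : Type*) [Field F] (n d : ℕ) (k : Fin (d + 1))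
    (a : Option (Fin n)) : MvPolynomial ((Fin d ⊕ Fin d) × Fin n) F :=
  Fin.lastCases (motive := fun _ => MvPolynomial ((Fin d ⊕ Fin d) × Fin n) F)
    (if a = none then 1 else 0) (fun l => a.elim 0 fun a => X (.inl l, a)) k

theorem eval_leftSelector (x : Fin d ⊕ Fin d → Fin n) (k : Fin (d + 1)) (a : Option (Fin n)) :
    eval (boolPoint F (oneHot x)) (leftSelector F n d k a) =
      if (shiftIndex (fun l => x (.inl l)) (fun l => x (.inr l)) k).1 = a then 1 else 0 := by
  cases k using Fin.cases with
  | zero => cases a <;> simp [leftSelector, shiftIndex]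
  | succ l => cases a <;> simp [leftSelector, shiftIndex, boolPoint, oneHot]

theorem eval_rightSelector (x : Fin d ⊕ Fin d → Fin n) (k : Fin (d + 1)) (a : Option (Fin n)) :
    eval (boolPoint F (oneHot x)) (rightSelector F n d k a) =
      if (shiftIndex (fun l => x (.inl l)) (fun l => x (.inr l)) k).2 = a then 1 else 0 := by
  cases k using Fin.lastCases with
  | last => cases a <;> simp [rightSelector, shiftIndex]
  | cast l => cases a <;> simp [rightSelector, shiftIndex, boolPoint, oneHot]

theorem formulaSize_leftSelector_le (k : Fin (d + 1)) (a : Option (Fin n)) :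
    formulaSize (leftSelector F n d k a) ≤ 1 := by
  cases k using Fin.cases with
  | zero => cases a <;> simp [leftSelector, formulaSize_one_le, formulaSize_zero_le]
  | succ l => cases a <;> simp [leftSelector, formulaSize_X_le, formulaSize_zero_le]

theorem formulaSize_rightSelector_le (k : Fin (d + 1)) (a : Option (Fin n)) :
    formulaSize (rightSelector F n d k a) ≤ 1 := by
  cases k using Fin.lastCases with
  | last => cases a <;> simp [rightSelector, formulaSize_one_le, formulaSize_zero_le]
  | cast l => cases a <;> simp [rightSelector, formulaSize_X_le, formulaSize_zero_le]

/-- The monomial of `qTilde` selected by a one-hot encoding. -/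
noncomputable def monomialSelector (F : Type*) [Field F] (n d : ℕ) :
    MvPolynomial (ShiftVar n d ⊕ ((Fin d ⊕ Fin d) × Fin n)) F :=
  ∏ k : Fin (d + 1), ∑ q : Option (Fin n) × Option (Fin n),
    rename Sum.inr (leftSelector F n d k q.1 * rightSelector F n d k q.2) * X (.inl (k, q))

theorem formulaSize_monomialSelector_le :
    formulaSize (monomialSelector F n d) ≤ (d + 1) * ((n + 1) * (n + 1) * 3 + 1) + 1 := by
  have h : ∀ k : Fin (d + 1), formulaSize (∑ q : Option (Fin n) × Option (Fin n),
      rename Sum.inr (leftSelector F n d k q.1 * rightSelector F n d k q.2) *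
        (X (.inl (k, q)) : MvPolynomial (ShiftVar n d ⊕ ((Fin d ⊕ Fin d) × Fin n)) F)) ≤
      (n + 1) * (n + 1) * 3 + 1 := by
    intro k
    refine (formulaSize_sum_le _ _ (b := 3) fun q _ => ?_).trans (by simp)
    refine (formulaSize_mul_le _ _).trans (Nat.add_le_add ((formulaSize_rename_le _ _).trans
      ((formulaSize_mul_le _ _).trans (Nat.add_le_add (formulaSize_leftSelector_le k q.1)
        (formulaSize_rightSelector_le k q.2)))) (formulaSize_X_le _))
  exact (formulaSize_prod_le Finset.univ _ fun k _ => h k).trans (by simp)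

theorem boolSubst_monomialSelector (x : Fin d ⊕ Fin d → Fin n) :
    boolSubst F (oneHot x) (monomialSelector F n d) = ∏ k : Fin (d + 1),
      X (k, shiftIndex (fun l => x (.inl l)) (fun l => x (.inr l)) k) := by
  simp only [monomialSelector, map_prod, map_sum, map_mul (boolSubst F _), boolSubst_rename_inr]
  refine Finset.prod_congr rfl fun k _ => ?_
  rw [Finset.sum_eq_single (shiftIndex (fun l => x (.inl l)) (fun l => x (.inr l)) k)]
  · simp [eval_leftSelector, eval_rightSelector, boolSubst]
  · rintro ⟨a, b⟩ - hab
    simp only [map_mul, eval_leftSelector, eval_rightSelector]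
    by_cases h1 : (shiftIndex (fun l => x (.inl l)) (fun l => x (.inr l)) k).1 = a
    · by_cases h2 : (shiftIndex (fun l => x (.inl l)) (fun l => x (.inr l)) k).2 = b
      · exact absurd (Prod.ext h1.symm h2.symm) hab
      · simp [h2]
    · simp [h1]
  · simp

/-- If the words for the entries of `M` can be computed by Boolean operations then `qTilde M` is a
Boolean sum of a polynomial with a small formula. -/
theorem exists_boolSum_eq_qTilde {M : Matrix (Fin d → Fin n) (Fin d → Fin n) F} {m P N : ℕ}
    (c : Fin m → F) {w : (Fin d ⊕ Fin d → Fin n) → List (Option (Fin m))}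
    (hM : ∀ x, wordValue c (w x) = M (fun k => x (.inl k)) fun k => x (.inr k))
    (hP : ∀ x, (w x).length ≤ P)
    (hN : Generates (inputTests (Fin d ⊕ Fin d) n) N (observe (listObs Finset.univ P) w)) :
    ∃ (E : Type) (_ : Fintype E) (_ : DecidableEq E) (G : MvPolynomial (ShiftVar n d ⊕ E) F),
      Fintype.card E ≤ 2 * d * n + N ∧
      formulaSize G ≤ ((d + 1) * ((n + 1) * (n + 1) * 3 + 1) + 1) +
        (2 * d * (n * (n * 3 + 1) + 1) + 1) + (37 * N + 1) + (P * (P * (2 * m + 3) + 2) + 1) ∧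
      ∑ e : E → Bool, boolSubst F e G = qTilde M := by
  obtain ⟨L, hL, hLN, hobs⟩ := hN
  obtain ⟨W, _, _, val, χ, hW, hχs, hχ, hv⟩ := exists_check_polynomial (F := F)
    (oneHot (D := Fin d ⊕ Fin d) (n := n)) (A := inputTests (Fin d ⊕ Fin d) n)
    (by rintro f ⟨k, a, rfl⟩; exact ⟨(k, a), rfl⟩) hL
  have ht : ∀ (p : ℕ) (o : Option (Option (Fin m))),
      ∃ t : MvPolynomial ((Fin d ⊕ Fin d) × Fin n ⊕ W) F, formulaSize t ≤ 1 ∧ (p < P → ∀ x,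
        eval (boolPoint F (Sum.elim (oneHot x) (val x))) t = if (w x)[p]? = o then 1 else 0) := by
    intro p o
    by_cases hp : p < P
    · obtain ⟨v, hv⟩ := hv _ (hobs _ (mem_observe (v := w) (mem_listObs hp (o := o)
        (Finset.mem_insertNone.2 fun a _ => Finset.mem_univ a))))
      refine ⟨X v, formulaSize_X_le v, fun _ x => ?_⟩
      rw [eval_X, boolPoint, hv]
      simp
    · exact ⟨0, formulaSize_zero_le, fun h => absurd h hp⟩
  choose t hts ht using ht
  obtain ⟨S, R, -, hSs, hS⟩ := exists_word_polynomial c hts P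
  have hSval : ∀ x, eval (boolPoint F (Sum.elim (oneHot x) (val x))) S =
      M (fun k => x (.inl k)) fun k => x (.inr k) := by
    intro x
    have := hS _ (w x) fun p hp o => ht p o hp x
    rw [List.take_of_length_le (hP x)] at this
    rw [← hM, wordValue_eq, ← this]
  -- The factors select the monomial, test the one-hot encoding, test the values of the program, and
  -- evaluate the matrix entry from them.
  refine ⟨(Fin d ⊕ Fin d) × Fin n ⊕ W, inferInstance, inferInstance,
    rename (Sum.map id Sum.inl) (monomialSelector F n d) *
      rename Sum.inr (rename Sum.inl (oneHotPoly F (Fin d ⊕ Fin d) n) * χ * S), ?_, ?_, ?_⟩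
  · simp only [Fintype.card_sum, Fintype.card_prod, Fintype.card_fin]
    rw [two_mul]
    omega
  · have h1 := formulaSize_oneHotPoly_le (F := F) (D := Fin d ⊕ Fin d) (n := n)
    simp only [Fintype.card_sum, Fintype.card_fin, ← two_mul] at h1
    refine (formulaSize_mul_le _ _).trans ?_
    rw [add_assoc, add_assoc]
    refine Nat.add_le_add ((formulaSize_rename_le _ _).trans formulaSize_monomialSelector_le)
      ((formulaSize_rename_le _ _).trans ((formulaSize_mul_le _ _).trans ?_))
    rw [← add_assoc]
    refine Nat.add_le_add ((formulaSize_mul_le _ _).trans (Nat.add_le_add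
      ((formulaSize_rename_le _ _).trans h1) (hχs.trans ?_))) hSs
    gcongr
  · rw [← (Equiv.sumArrowEquivProdArrow ((Fin d ⊕ Fin d) × Fin n) W Bool).symm.sum_comp,
      Fintype.sum_prod_type]
    have hterm : ∀ (e : (Fin d ⊕ Fin d) × Fin n → Bool) (v : W → Bool),
        boolSubst F ((Equiv.sumArrowEquivProdArrow ((Fin d ⊕ Fin d) × Fin n) W Bool).symm (e, v))
          (rename (Sum.map id Sum.inl) (monomialSelector F n d) *
            rename Sum.inr (rename Sum.inl (oneHotPoly F (Fin d ⊕ Fin d) n) * χ * S)) =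
        ∑ x, if e = oneHot x then boolSubst F e (monomialSelector F n d) *
          C (eval (boolPoint F (Sum.elim e v)) χ * eval (boolPoint F (Sum.elim e v)) S) else 0 := by
      intro e v
      have h1 : (Equiv.sumArrowEquivProdArrow ((Fin d ⊕ Fin d) × Fin n) W Bool).symm (e, v) =
        Sum.elim e v := rfl
      have h2 : boolPoint F (Sum.elim e v) ∘ Sum.inl = boolPoint F e := rfl
      rw [h1, map_mul, boolSubst_rename_map, boolSubst_rename_inr, map_mul (eval _),
        map_mul (eval _), eval_rename, h2, eval_oneHotPoly, Finset.sum_mul, Finset.sum_mul, map_sum, Finset.mul_sum]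
      refine Finset.sum_congr rfl fun x _ => ?_
      split_ifs
      · simp only [Sum.elim_inl, one_mul]
      · simp
    simp only [hterm]
    -- With the sum over `x` outside, only `e = oneHot x` and `v = val x` contribute for each `x`.
    rw [Finset.sum_congr rfl fun e _ => Finset.sum_comm, Finset.sum_comm]
    have hx : ∀ x : Fin d ⊕ Fin d → Fin n, (∑ e : (Fin d ⊕ Fin d) × Fin n → Bool,
        ∑ v : W → Bool, if e = oneHot x then boolSubst F e (monomialSelector F n d) *
          C (eval (boolPoint F (Sum.elim e v)) χ * eval (boolPoint F (Sum.elim e v)) S) else 0) =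
        C (M (fun k => x (.inl k)) fun k => x (.inr k)) * ∏ k : Fin (d + 1),
          X (k, shiftIndex (fun l => x (.inl l)) (fun l => x (.inr l)) k) := by
      intro x
      rw [Finset.sum_eq_single (oneHot x), Finset.sum_eq_single (val x)]
      · rw [if_pos rfl, boolSubst_monomialSelector, hχ, hSval, if_pos rfl, one_mul, mul_comm]
      · intro v _ hv
        rw [if_pos rfl, hχ, if_neg hv, zero_mul, map_zero, mul_zero]
      · simp
      · intro e _ he
        simp [he]
      · simp
    simp only [hx]
    rw [← (Equiv.sumArrowEquivProdArrow (Fin d) (Fin d) (Fin n)).symm.sum_comp,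
      Fintype.sum_prod_type]
    rfl

end Arithmetization

/-! ### Polynomially bounded functions -/

section PolyBounded

open Filter

/-- Lower-order terms are absorbed by a larger exponent, and finitely many exceptional values by the
additive constant. -/
theorem polyBounded_iff {t : ℕ → ℕ} : PolyBounded t ↔ ∃ c : ℕ, ∀ᶠ n in atTop, t n ≤ n ^ c := by
  constructor
  · rintro ⟨c, hc⟩
    refine ⟨c + 1, ?_⟩
    filter_upwards [eventually_ge_atTop 2] with n hn
    have h1 : c < n ^ c := Nat.lt_pow_self hn
    have h2 : n ^ c * 2 ≤ n ^ c * n := Nat.mul_le_mul_left _ hn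
    have := hc n
    rw [pow_succ]
    omega
  · rintro ⟨c, hc⟩
    obtain ⟨N, hN⟩ := eventually_atTop.1 hc
    -- The sum covers all `n < N`; the summand 1 covers `n = 0`, where `0 ^ c` may be 1.
    refine ⟨c + 1 + ∑ n ∈ Finset.range N, t n, fun n => ?_⟩
    rcases Nat.lt_or_ge n N with h | h
    · have := Finset.single_le_sum (f := t) (fun _ _ => Nat.zero_le _) (Finset.mem_range.2 h)
      omega
    · refine (hN n h).trans ?_
      rcases Nat.eq_zero_or_pos n with rfl | hn
      · have : 0 ^ c ≤ 1 := pow_le_one₀ (Nat.zero_le 0) zero_le_one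
        exact (this.trans (by omega)).trans (Nat.le_add_left _ _)
      · exact (Nat.pow_le_pow_right hn (by omega)).trans (Nat.le_add_right _ _)

namespace PolyBounded

variable {s t : ℕ → ℕ}

theorem of_eventually_le (ht : PolyBounded t) (h : ∀ᶠ n in atTop, s n ≤ t n) : PolyBounded s := by
  obtain ⟨c, hc⟩ := polyBounded_iff.1 ht
  refine polyBounded_iff.2 ⟨c, ?_⟩
  filter_upwards [hc, h] with n h1 h2 using h2.trans h1

protected theorem const (c : ℕ) : PolyBounded fun _ => c :=
  ⟨c, fun _ => Nat.le_add_left _ _⟩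

protected theorem id : PolyBounded fun n => n :=
  ⟨1, fun n => by simp⟩

protected theorem add (hs : PolyBounded s) (ht : PolyBounded t) :
    PolyBounded fun n => s n + t n := by
  obtain ⟨a, ha⟩ := polyBounded_iff.1 hs
  obtain ⟨b, hb⟩ := polyBounded_iff.1 ht
  refine polyBounded_iff.2 ⟨a + b + 1, ?_⟩
  filter_upwards [ha, hb, eventually_ge_atTop 2] with n h1 h2 hn
  have h3 : n ^ a ≤ n ^ (a + b) := Nat.pow_le_pow_right (by omega) (by omega)
  have h4 : n ^ b ≤ n ^ (a + b) := Nat.pow_le_pow_right (by omega) (by omega)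
  have h5 : n ^ (a + b) * 2 ≤ n ^ (a + b) * n := Nat.mul_le_mul_left _ hn
  rw [pow_succ]
  omega

protected theorem mul (hs : PolyBounded s) (ht : PolyBounded t) :
    PolyBounded fun n => s n * t n := by
  obtain ⟨a, ha⟩ := polyBounded_iff.1 hs
  obtain ⟨b, hb⟩ := polyBounded_iff.1 ht
  refine polyBounded_iff.2 ⟨a + b, ?_⟩
  filter_upwards [ha, hb] with n h1 h2
  rw [pow_add]
  exact Nat.mul_le_mul h1 h2

protected theorem pow (hs : PolyBounded s) (k : ℕ) : PolyBounded fun n => s n ^ k := by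
  induction k with
  | zero => simpa using PolyBounded.const 1
  | succ k ih => simpa only [pow_succ] using ih.mul hs

end PolyBounded

end PolyBounded

/-! ### Circuits from formulas -/

section Circuits

variable {F V : Type*} [Field F]

/-- The results of the gates of a circuit. -/
noncomputable def ArithCircuit.values (Γ : ArithCircuit F V) : List (MvPolynomial V F) :=
  Γ.foldl (fun prev g => prev ++ [g.value prev]) []

theorem ArithCircuit.values_concat (Γ : ArithCircuit F V) (g : ArithGate F V) :
    ArithCircuit.values (Γ ++ [g]) = ArithCircuit.values Γ ++ [g.value (ArithCircuit.values Γ)] := by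
  simp [ArithCircuit.values]

/-- An arbitrary prefix `Γ` is needed because gates refer to absolute positions and the second
argument is laid out after the first. A binary tree has one inner node fewer than leaves, whence the
bound. -/
theorem ArithFormula.exists_circuit_append (φ : ArithFormula F V) (Γ : ArithCircuit F V) :
    ∃ (Δ : ArithCircuit F V) (L : List (MvPolynomial V F)), Δ.length + 1 ≤ 2 * φ.size ∧
      ArithCircuit.values (Γ ++ Δ) = ArithCircuit.values Γ ++ L ++ [φ.eval] := by
  induction φ generalizing Γ with
  | const c => exact ⟨[.const c], [], le_rfl, by rw [ArithCircuit.values_concat]; simp [eval,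
      ArithGate.value]⟩
  | var x => exact ⟨[.var x], [], le_rfl, by rw [ArithCircuit.values_concat]; simp [eval,
      ArithGate.value]⟩
  | add φ ψ h1 h2 =>
    obtain ⟨Δ₁, L₁, hΔ₁, h1⟩ := h1 Γ
    obtain ⟨Δ₂, L₂, hΔ₂, h2⟩ := h2 (Γ ++ Δ₁)
    refine ⟨Δ₁ ++ Δ₂ ++ [.add (ArithCircuit.values Γ ++ L₁).length
      (ArithCircuit.values (Γ ++ Δ₁) ++ L₂).length], L₁ ++ [φ.eval] ++ L₂ ++ [ψ.eval], ?_, ?_⟩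
    · simp only [List.length_append, List.length_singleton, size]
      omega
    · rw [← List.append_assoc, ← List.append_assoc, ArithCircuit.values_concat, h2]
      congr 1
      · rw [h1]
        simp
      · simp only [ArithGate.value, eval]
        congr 3
        · rw [h1]
          simp [List.getD_eq_getElem?_getD]
        · simp [List.getD_eq_getElem?_getD]
  | mul φ ψ h1 h2 =>
    obtain ⟨Δ₁, L₁, hΔ₁, h1⟩ := h1 Γ
    obtain ⟨Δ₂, L₂, hΔ₂, h2⟩ := h2 (Γ ++ Δ₁)
    refine ⟨Δ₁ ++ Δ₂ ++ [.mul (ArithCircuit.values Γ ++ L₁).length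
      (ArithCircuit.values (Γ ++ Δ₁) ++ L₂).length], L₁ ++ [φ.eval] ++ L₂ ++ [ψ.eval], ?_, ?_⟩
    · simp only [List.length_append, List.length_singleton, size]
      omega
    · rw [← List.append_assoc, ← List.append_assoc, ArithCircuit.values_concat, h2]
      congr 1
      · rw [h1]
        simp
      · simp only [ArithGate.value, eval]
        congr 3
        · rw [h1]
          simp [List.getD_eq_getElem?_getD]
        · simp [List.getD_eq_getElem?_getD]

theorem exists_circuit_length_le (p : MvPolynomial V F) :
    ∃ Γ : ArithCircuit F V, Γ.eval = p ∧ Γ.length ≤ 2 * formulaSize p := by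
  obtain ⟨φ, rfl, hφ⟩ := exists_formula_size_eq p
  obtain ⟨Γ, L, hΓ, h⟩ := φ.exists_circuit_append []
  refine ⟨Γ, ?_, by omega⟩
  rw [List.nil_append] at h
  have : Γ.eval = (ArithCircuit.values Γ).getLastD 0 := rfl
  rw [this, h, List.getLastD_concat]

theorem totalDegree_le_formulaSize (p : MvPolynomial V F) : p.totalDegree ≤ formulaSize p := by
  obtain ⟨φ, rfl, hφ⟩ := exists_formula_size_eq p
  rw [← hφ]
  exact φ.totalDegree_eval_le

theorem mem_VP_of_formulaSize {f : PolySeq F} {s : ℕ → ℕ} (hs : PolyBounded s)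
    (hv : PolyBounded f.numVars) (h : ∀ n, formulaSize (f.poly n) ≤ s n) : f ∈ VP F := by
  refine ⟨⟨hv, hs.of_eventually_le (Filter.Eventually.of_forall fun n =>
    (totalDegree_le_formulaSize _).trans (h n))⟩, fun n => 2 * s n, (PolyBounded.const 2).mul hs,
    fun n => ?_⟩
  obtain ⟨Γ, h1, h2⟩ := exists_circuit_length_le (f.poly n)
  exact ⟨Γ, h1, h2.trans (Nat.mul_le_mul_left _ (h n))⟩

end Circuits

/-! ### Membership in `VNP` -/

section VNPMembership

open MvPolynomial

variable {F : Type*} [Field F]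

/-- A Boolean sum over variables from a finite type, written with numbered variables. -/
theorem exists_numbered_boolSum {S E : Type*} [Fintype S] [Fintype E] [DecidableEq E]
    (G : MvPolynomial (S ⊕ E) F) :
    ∃ g : MvPolynomial (Fin (Fintype.card S + Fintype.card E)) F,
      formulaSize g ≤ formulaSize G ∧
      rename (Fintype.equivFin S) (∑ e : E → Bool, boolSubst F e G) =
        ∑ e : Fin (Fintype.card E) → Bool, aeval (Fin.append (fun k => X k)
          (fun k => if e k then (1 : MvPolynomial (Fin (Fintype.card S)) F) else 0)) g := by
  refine ⟨rename (fun v => finSumFinEquiv (Sum.map (Fintype.equivFin S) (Fintype.equivFin E) v)) G,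
    formulaSize_rename_le _ _, ?_⟩
  rw [map_sum]
  refine Fintype.sum_equiv (Equiv.arrowCongr (Fintype.equivFin E) (Equiv.refl Bool)) _ _ fun e => ?_
  rw [aeval_rename, boolSubst, comp_aeval_apply]
  congr 2
  funext v
  rcases v with v | v
  · simp
  · simp only [Sum.elim_inr, Function.comp_apply, Sum.map_inr, finSumFinEquiv_apply_right,
      Fin.append_right, Equiv.arrowCongr_apply, Equiv.symm_apply_apply, Equiv.coe_refl, id]
    split_ifs <;> simp

/-- Finitely many `n` may be ignored, since polynomial bounds are insensitive to them. This is used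
for `n = 0`, about which explicitness says nothing. -/
theorem mem_VNP_of_boolSum {f : PolySeq F} (hf : f.IsPFamily) {s : ℕ → ℕ} (hs : PolyBounded s)
    (h : ∀ᶠ n in Filter.atTop, ∃ u ≤ s n, ∃ g : MvPolynomial (Fin (f.numVars n + u)) F,
      formulaSize g ≤ s n ∧ f.poly n = ∑ e : Fin u → Bool, aeval (Fin.append (fun k => X k)
        (fun k => if e k then (1 : MvPolynomial (Fin (f.numVars n)) F) else 0)) g) :
    f ∈ VNP F := by
  have key : ∀ n, ∃ u, ∃ g : MvPolynomial (Fin (f.numVars n + u)) F,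
      f.poly n = ∑ e : Fin u → Bool, aeval (Fin.append (fun k => X k)
        (fun k => if e k then (1 : MvPolynomial (Fin (f.numVars n)) F) else 0)) g ∧
      ((∃ u ≤ s n, ∃ g : MvPolynomial (Fin (f.numVars n + u)) F,
        formulaSize g ≤ s n ∧ f.poly n = ∑ e : Fin u → Bool, aeval (Fin.append (fun k => X k)
        (fun k => if e k then (1 : MvPolynomial (Fin (f.numVars n)) F) else 0)) g) →
        u ≤ s n ∧ formulaSize g ≤ s n) := by
    intro n
    by_cases hn : ∃ u ≤ s n, ∃ g : MvPolynomial (Fin (f.numVars n + u)) F,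
        formulaSize g ≤ s n ∧ f.poly n = ∑ e : Fin u → Bool, aeval (Fin.append (fun k => X k)
        (fun k => if e k then (1 : MvPolynomial (Fin (f.numVars n)) F) else 0)) g
    · obtain ⟨u, hu, g, hg, e⟩ := hn
      exact ⟨u, g, e, fun _ => ⟨hu, hg⟩⟩
    -- For an exceptional `n` the polynomial is its own Boolean sum over no variables.
    · refine ⟨0, rename (Fin.castAdd 0) (f.poly n), ?_, fun h => absurd h hn⟩
      rw [Fintype.sum_unique, aeval_rename]
      have : ∀ b : Fin 0 → MvPolynomial (Fin (f.numVars n)) F,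
          Fin.append (fun k => X k) b ∘ Fin.castAdd 0 =
            (X : _ → MvPolynomial (Fin (f.numVars n)) F) := fun b => by
        funext k
        exact Fin.append_left _ _ k
      rw [this, aeval_X_left_apply]
  choose u g hfg hug using key
  have hu : PolyBounded u := hs.of_eventually_le (h.mono fun n hn => (hug n hn).1)
  have hg : PolyBounded fun n => formulaSize (g n) :=
    hs.of_eventually_le (h.mono fun n hn => (hug n hn).2)
  exact ⟨hf, u, hu, g, mem_VP_of_formulaSize hg (hf.1.add hu) fun n => le_rfl, hfg⟩

theorem totalDegree_qTilde_le {n d : ℕ} (M : Matrix (Fin d → Fin n) (Fin d → Fin n) F) :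
    (qTilde M).totalDegree ≤ d + 1 := by
  refine totalDegree_finsetSum_le fun i _ => totalDegree_finsetSum_le fun j _ => ?_
  refine (totalDegree_mul _ _).trans ?_
  rw [totalDegree_C, zero_add]
  refine (totalDegree_finsetProd _ _).trans ?_
  simp

/-- The polynomials `qTilde (M n)` with numbered variables. -/
noncomputable def qTildeSeq {d : ℕ → ℕ}
    (M : ∀ n, Matrix (Fin (d n) → Fin n) (Fin (d n) → Fin n) F) : PolySeq F where
  numVars n := Fintype.card (ShiftVar n (d n))
  poly n := rename (Fintype.equivFin _) (qTilde (M n))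

/-- The running time `t`, the output length `P`, the program length `N` and the formula size `B` are
all polynomially bounded; of the polylogarithmic time only its polynomial boundedness is needed. -/
theorem qTildeSeq_mem_VNP {d : ℕ → ℕ} (hd : PolyBounded d)
    {M : ∀ n, Matrix (Fin (d n) → Fin n) (Fin (d n) → Fin n) F} (hM : IsExplicit d M) :
    qTildeSeq M ∈ VNP F := by
  obtain ⟨m, c, T, a, hT⟩ := hM
  obtain ⟨C, hC⟩ := exists_generates_output T
  have hn := PolyBounded.id
  have hk := PolyBounded.const
  have hlog : PolyBounded fun n => (Nat.log 2 n + 2) ^ a :=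
    PolyBounded.pow ((hn.of_eventually_le (Filter.Eventually.of_forall fun n =>
      Nat.log_le_self 2 n)).add (hk 2)) a
  let t : ℕ → ℕ := fun n => (Nat.log 2 n + 2) ^ a
  let P : ℕ → ℕ := fun n => (2 * d n + 1) * (n + 1) + t n * C
  let N : ℕ → ℕ := fun n =>
    1 + ((2 * d n + 1) * ((P n + t n * C) * 4 * (n * 3 + 1)) + (P n + t n * C) * 4 * 4) +
      C * (P n + t n * C + 1) + t n * (C * (P n + t n * C + 1))
  let B : ℕ → ℕ := fun n => ((d n + 1) * ((n + 1) * (n + 1) * 3 + 1) + 1) +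
    (2 * d n * (n * (n * 3 + 1) + 1) + 1) + (37 * N n + 1) +
      (P n * (P n * (2 * m + 3) + 2) + 1)
  have hd2 : PolyBounded fun n => 2 * d n := (hk 2).mul hd
  have hn1 : PolyBounded fun n => n + 1 := hn.add (hk 1)
  have hn3 : PolyBounded fun n => n * 3 + 1 := (hn.mul (hk 3)).add (hk 1)
  have hP : PolyBounded P := ((hd2.add (hk 1)).mul hn1).add (hlog.mul (hk C))
  have hPt : PolyBounded fun n => P n + t n * C := hP.add (hlog.mul (hk C))
  have hCP : PolyBounded fun n => C * (P n + t n * C + 1) := (hk C).mul (hPt.add (hk 1))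
  have hN : PolyBounded N :=
    (((hk 1).add (((hd2.add (hk 1)).mul ((hPt.mul (hk 4)).mul hn3)).add
      ((hPt.mul (hk 4)).mul (hk 4)))).add hCP).add (hlog.mul hCP)
  have hB : PolyBounded B :=
    ((((((hd.add (hk 1)).mul (((hn1.mul hn1).mul (hk 3)).add (hk 1)))).add (hk 1)).add
      ((hd2.mul ((hn.mul hn3).add (hk 1))).add (hk 1))).add (((hk 37).mul hN).add (hk 1))).add
      ((hP.mul ((hP.mul (hk (2 * m + 3))).add (hk 2))).add (hk 1))
  refine mem_VNP_of_boolSum (s := fun n => (2 * d n * n + N n) + B n) ⟨?_, ?_⟩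
    (((hd2.mul hn).add hN).add hB) ?_
  · refine ((hd.add (hk 1)).mul (hn1.mul hn1)).of_eventually_le
      (Filter.Eventually.of_forall fun n => le_of_eq ?_)
    simp [qTildeSeq]
  · exact (hd.add (hk 1)).of_eventually_le (Filter.Eventually.of_forall fun n =>
      (totalDegree_rename_le _ _).trans (totalDegree_qTilde_le _))
  · filter_upwards [Filter.eventually_gt_atTop 0] with n hn
    choose w hw hout using fun x : Fin (d n) ⊕ Fin (d n) → Fin n =>
      hT n hn (fun k => x (.inl k)) fun k => x (.inr k)
    obtain ⟨hlen, hgen⟩ := hC n (d n) (t n) w hout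
    obtain ⟨E, _, _, G, hE, hG, hsum⟩ := exists_boolSum_eq_qTilde c hw hlen (hgen (P n))
    obtain ⟨g, hg, hgsum⟩ := exists_numbered_boolSum G
    rw [hsum] at hgsum
    exact ⟨Fintype.card E, hE.trans (Nat.le_add_right _ _), g,
      (hg.trans hG).trans (Nat.le_add_left _ _), hgsum⟩

theorem exists_formulaSize_qTilde_le_of_mem_VNC1 {d : ℕ → ℕ}
    {M : ∀ n, Matrix (Fin (d n) → Fin n) (Fin (d n) → Fin n) F} (h : qTildeSeq M ∈ VNC1 F) :
    ∃ c : ℕ, ∀ᶠ n in Filter.atTop, formulaSize (qTilde (M n)) ≤ n ^ c := by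
  obtain ⟨-, s, hs, hφ⟩ := h
  obtain ⟨c, hc⟩ := polyBounded_iff.1 hs
  refine ⟨c, hc.mono fun n hn => le_trans ?_ hn⟩
  obtain ⟨φ, h1, h2⟩ := hφ n
  have h3 : qTilde (M n) = rename (Fintype.equivFin _).symm φ.eval := by
    rw [h1]
    simp [qTildeSeq, rename_rename]
  rw [h3]
  exact (formulaSize_rename_le _ _).trans ((formulaSize_le φ).trans h2)

end VNPMembership

/-! ### The main theorem. -/

theorem polyBounded_of_isBigO {d : ℕ → ℕ}
    (hd : Asymptotics.IsBigO Filter.atTop (fun n : ℕ => (d n : ℝ))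
      (fun n : ℕ => Real.log n / Real.log (Real.log n))) : PolyBounded d := by
  obtain ⟨C, hC0, hC⟩ := hd.exists_pos
  rw [Asymptotics.IsBigOWith] at hC
  have hlog : Filter.Tendsto (fun n : ℕ => Real.log n) Filter.atTop Filter.atTop :=
    Real.tendsto_log_atTop.comp tendsto_natCast_atTop_atTop
  obtain ⟨k, hk⟩ := exists_nat_ge C
  refine ((PolyBounded.const k).mul PolyBounded.id).of_eventually_le ?_
  filter_upwards [hC, hlog.eventually_ge_atTop 0,
    (Real.tendsto_log_atTop.comp hlog).eventually_ge_atTop 1] with n hn h0 h1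
  simp only [Function.comp_apply] at h1
  rw [Real.norm_of_nonneg (by positivity), Real.norm_of_nonneg (by positivity)] at hn
  have h2 : (d n : ℝ) ≤ k * n := by
    calc (d n : ℝ) ≤ C * (Real.log n / Real.log (Real.log n)) := hn
      _ ≤ k * n := by
        gcongr
        exact (div_le_self h0 h1).trans (Real.log_le_self (Nat.cast_nonneg n))
  exact_mod_cast h2

theorem corollary1p5 {F : Type*} [Field F] (d : ℕ → ℕ)
    (M : ∀ n, Matrix (Fin (d n) → Fin n) (Fin (d n) → Fin n) F)
    (hM : IsExplicit d M)
    (hd_lower : Filter.Tendsto d Filter.atTop Filter.atTop)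
    (hd_upper : Asymptotics.IsBigO Filter.atTop (fun n : ℕ => (d n : ℝ))
      (fun n : ℕ => Real.log n / Real.log (Real.log n)))
    (hrank : ∃ δ : ℕ → ℝ,
      Asymptotics.IsLittleO Filter.atTop δ (fun n : ℕ => Real.logb 2 (d n)) ∧
      ∀ᶠ n : ℕ in Filter.atTop, (ptRank (M n) : ℝ) = (n : ℝ) ^ ((d n : ℝ) - δ n)) :
    (∃ ε : ℕ → ℝ, Filter.Tendsto ε Filter.atTop (nhds 0) ∧
      ∀ᶠ n : ℕ in Filter.atTop,
        (n : ℝ) ^ ((1 - ε n) * Real.logb 2 (d n)) ≤ (formulaSize (qTilde (M n)) : ℝ)) ∧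
    VNC1 F ≠ VNP F := by
  obtain ⟨δ, hδ, hrank⟩ := hrank
  have key : ∀ η : ℝ, 0 < η → ∀ᶠ n : ℕ in Filter.atTop,
      (n : ℝ) ^ ((1 - η) * Real.logb 2 (d n)) ≤ (formulaSize (qTilde (M n)) : ℝ) :=
    fun η hη => eventually_rpow_le_formulaSize hd_lower hd_upper hδ hrank hη
  refine ⟨exists_rpow_le_formulaSize hd_lower key, fun h => ?_⟩
  -- If the classes were equal, this family would have formulas of size `n ^ c`, contradicting `n ^
  -- (log₂ d / 2)` with `d → ∞`.
  have hmem := qTildeSeq_mem_VNP (polyBounded_of_isBigO hd_upper) hM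
  rw [← h] at hmem
  obtain ⟨c, hc⟩ := exists_formulaSize_qTilde_le_of_mem_VNC1 hmem
  exact not_eventually_formulaSize_le hd_lower key c hc
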